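/- For integers $m,k\ge 1$ and $p\in(0,1]$ let $\boldsymbol U=(U^A,U^B)$ be the random two-player game in which player $A$ has action set $\{1,\dots,m\}$, player $B$ has action set $\{1,\dots,k\}$, and the payoff pairs $(U^A(a,b),U^B(a,b))$ at different action profiles $(a,b)$ are independent and identically distributed as follows: with probability $p$ the two payoffs are equal to the same random variable uniform on $[0,1]$, and with probability $1-p$ they are two independent random variables uniform on $[0,1]$. A profile $(a^*,b^*)$ is a pure Nash equilibrium (PNE) if $U^A(a^*,b^*)\ge U^A(a,b^*)$ for all $a$ and $U^B(a^*,b^*)\ge U^B(a^*,b)$ for all $b$. The best response dynamics is the process with $\mathrm{BRD}(0)=(1,1)$ and, if $\mathrm{BRD}(t)=(a,b)$: for even $t$, $\mathrm{BRD}(t+1)=(a',b)$ where $a'$ is an element of $\arg\max_{x} U^A(x,b)\setminus\{a\}$ if this set is nonempty and $a'=a$ otherwise; for odd $t$, $\mathrm{BRD}(t+1)=(a,b')$ where $b'$ is an element of $\arg\max_{y} U^B(a,y)\setminus\{b\}$ if this set is nonempty and $b'=b$ otherwise. (Almost surely each player's payoffs have no ties, so that the process is well defined; ties are broken in favour of the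 smallest action.) Let $\tau^{\mathrm{NE}}=\min\{t\ge 0:\mathrm{BRD}(t)\text{ is a PNE}\}$, with $\tau^{\mathrm{NE}}=\infty$ if no such $t$ exists. Let $K^A_n,K^B_n\ge 1$ be sequences of integers that both diverge to $\infty$, put $K_n=\min(K^A_n,K^B_n)$, let $p_n\in(0,1]$, and let $\tau^{\mathrm{NE}}_n$ be the time above for the random game with $m=K^A_n$, $k=K^B_n$, $p=p_n$. Assume $$\lim_{n\to\infty}\frac{\log p_n}{\log K_n}=0 .$$ Then for every real sequence $\ell_n$ with $\lim_{n\to\infty}\ell_n=\infty$ and $\lim_{n\to\infty}\frac{\log p_n}{\log \ell_n}=0$ we have $$\lim_{n\to\infty}\mathsf P\bigl(\tau^{\mathrm{NE}}_n>\ell_n\bigr)=0 .$$ In particular, $\lim_{n\to\infty}\mathsf P(\tau^{\mathrm{NE}}_n=\infty)=0$. -/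

import Mathlib

open Filter Topology MeasureTheory

namespace RandomGame

/-- Action profiles `(a, b)`; player A has `m` actions and player B has `k` actions. -/
abbrev Profile (m k : ℕ) : Type := Fin m × Fin k

/-- A payoff bimatrix: `(U (a, b)).1` is A's payoff and `(U (a, b)).2` is B's payoff. -/
abbrev Game (m k : ℕ) : Type := Profile m k → ℝ × ℝ

/-- `s` is a pure Nash equilibrium of the game `U`. -/
def IsPNE {m k : ℕ} (U : Game m k) (s : Profile m k) : Prop :=
  (∀ a : Fin m, (U (a, s.2)).1 ≤ (U s).1) ∧ (∀ b : Fin k, (U (s.1, b)).2 ≤ (U s).2)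

open Classical in
/-- A's best responses to the action `b` of B. -/
noncomputable def argmaxA {m k : ℕ} (U : Game m k) (b : Fin k) : Finset (Fin m) :=
  Finset.univ.filter fun a => ∀ a' : Fin m, (U (a', b)).1 ≤ (U (a, b)).1

open Classical in
/-- B's best responses to the action `a` of A. -/
noncomputable def argmaxB {m k : ℕ} (U : Game m k) (a : Fin m) : Finset (Fin k) :=
  Finset.univ.filter fun b => ∀ b' : Fin k, (U (a, b')).2 ≤ (U (a, b)).2

open Classical in
/-- The active player's new action: an element of `S \ {x}` if there is one, otherwise `x`.
When payoffs have no ties (an almost sure event below), `S` is a singleton and there is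
nothing to choose; otherwise the smallest candidate is taken. -/
noncomputable def respond {m : ℕ} (S : Finset (Fin m)) (x : Fin m) : Fin m :=
  if h : (S \ {x}).Nonempty then (S \ {x}).min' h else x

/-- Best response dynamics started at `s₀`: A moves at even times, B moves at odd times. -/
noncomputable def brd {m k : ℕ} (U : Game m k) (s₀ : Profile m k) : ℕ → Profile m k
  | 0 => s₀
  | t + 1 =>
    let s := brd U s₀ t
    if Even t then (respond (argmaxA U s.2) s.1, s.2)
    else (s.1, respond (argmaxB U s.1) s.2)

/-- The first time at which the best response dynamics is in a pure Nash equilibrium;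
the value is `⊤` if this never happens. -/
noncomputable def tauNE {m k : ℕ} (U : Game m k) (s₀ : Profile m k) : ℕ∞ :=
  ⨅ (t : ℕ) (_ : IsPNE U (brd U s₀ t)), (t : ℕ∞)

/-- The uniform distribution on `[0, 1]`. -/
noncomputable def unif : Measure ℝ := volume.restrict (Set.Icc 0 1)

/-- The joint law of the two payoffs at one action profile: with probability `p` they are equal
to the same uniform variable, with probability `1 - p` they are independent uniform variables. -/
noncomputable def payoffLaw (p : ℝ) : Measure (ℝ × ℝ) :=
  ENNReal.ofReal p • unif.map (fun x => (x, x)) + ENNReal.ofReal (1 - p) • unif.prod unif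

/-- The law of the random game with parameter `p`: payoff pairs at different action profiles
are independent with common law `payoffLaw p`. -/
noncomputable def gameLaw (m k : ℕ) (p : ℝ) : Measure (Game m k) :=
  Measure.pi fun _ => payoffLaw p

end RandomGame

/-! Couple the dynamics with a greedy path that ignores used actions: with `(a 0, b 0)` the start,
`a (j+1)` is A's best reply to `b j` among rows outside `a 0, ..., a j`, and `b (j+1)` is B's best
reply to `a (j+1)` among columns outside `b 0, ..., b j`. The sets of cells inspected in the `2T`
steps are disjoint, so a prescribed path has probability at most the product of the inverse set
sizes (`Exploration.real_event_le`). That product is the inverse of the bound on the number of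
paths, hence a bound relative to each path survives the union over all paths without loss.

Two things can go wrong along a path. A used action may beat a fresh maximum: each such comparison
costs a factor of order `1/K`, and there are of order `T^2` of them (`real_usedRowWins_le`,
`real_usedColWins_le`). If none does, the dynamics follows the path (`IsFreshPath.follow`), and it
avoids equilibria only if every pivot is rejected by the player to move. With probability `p` the
two payoffs of a pivot coincide; being already the maximum of a set `C`, the pivot then survives
comparison with the maximum of a set `D` no larger than `C` with probability at least `1/2`. Each
block therefore contributes a factor `1 - p/2` (`pi_block_le`), and disjoint blocks multiply.

This gives `real_no_equilibrium_le`. The limit follows by running the path for a number of steps of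
order `L = min (ℓ, K^(1/4))`: the log conditions make `p * L` diverge, while `L^2 / K` vanishes. -/

namespace RandomGame

/-! ### Independence, resampling and symmetry of product measures -/

section Product

/-- The event `G` is determined by the coordinates in `B`. -/
def DeterminedBy {ι X : Type*} (G : Set (ι → X)) (B : Finset ι) : Prop :=
  ∀ U V : ι → X, (∀ c ∈ B, U c = V c) → U ∈ G → V ∈ G

lemma DeterminedBy.mono {ι X : Type*} {G : Set (ι → X)} {B B' : Finset ι} (h : DeterminedBy G B)
    (hB : B ⊆ B') : DeterminedBy G B' :=
  fun U V hUV hU => h U V (fun c hc => hUV c (hB hc)) hU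

lemma DeterminedBy.inter {ι X : Type*} {G H : Set (ι → X)} {B : Finset ι} (hG : DeterminedBy G B)
    (hH : DeterminedBy H B) : DeterminedBy (G ∩ H) B :=
  fun U V hUV hU => ⟨hG U V hUV hU.1, hH U V hUV hU.2⟩

variable {ι X : Type*} [Fintype ι] [DecidableEq ι] [MeasurableSpace X]

/-- Independence of disjoint coordinate blocks, in the form used to peel exploration steps off one
at a time. -/
lemma pi_real_inter_of_disjoint (ν : Measure X) [IsProbabilityMeasure ν]
    {G H : Set (ι → X)} (hGm : MeasurableSet G) (hHm : MeasurableSet H) {B B' : Finset ι}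
    (hG : DeterminedBy G B) (hH : DeterminedBy H B') (hB : Disjoint B B') :
    (Measure.pi fun _ : ι => ν).real (G ∩ H) =
      (Measure.pi fun _ : ι => ν).real G * (Measure.pi fun _ : ι => ν).real H := by
  classical
  obtain ⟨x₀⟩ : Nonempty X := by
    by_contra hX
    rw [not_nonempty_iff] at hX
    have := measure_univ (μ := ν)
    simp [Set.univ_eq_empty_iff.2 hX] at this
  have hind : ProbabilityTheory.iIndepFun (fun (i : ι) (U : ι → X) => U i)
      (Measure.pi fun _ : ι => ν) :=
    ProbabilityTheory.iIndepFun_pi (X := fun _ => id) (fun _ => aemeasurable_id)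
  have h2 := hind.indepFun_finset B B' hB (fun i => measurable_pi_apply i)
  -- Padding with the arbitrary value `x₀` writes a determined event as a preimage under restriction
  -- to the block.
  let ext : ∀ S : Finset ι, (S → X) → ι → X := fun S w i => if h : i ∈ S then w ⟨i, h⟩ else x₀
  have hext : ∀ S, Measurable (ext S) := by
    intro S
    refine measurable_pi_lambda _ fun i => ?_
    by_cases h : i ∈ S
    · simpa [ext, h] using measurable_pi_apply _
    · simp [ext, h]
  have key : ∀ (E : Set (ι → X)) (S : Finset ι), DeterminedBy E S →
      E = (fun (U : ι → X) (i : S) => U i) ⁻¹' (ext S ⁻¹' E) := by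
    intro E S hE
    ext U
    constructor
    · intro hU
      exact hE U _ (fun c hc => by simp [ext, hc]) hU
    · intro hU
      exact hE _ U (fun c hc => by simp [ext, hc]) hU
  have := h2.measure_inter_preimage_eq_mul (ext B ⁻¹' G) (ext B' ⁻¹' H)
    (hext B hGm) (hext B' hHm)
  rw [← key G B hG, ← key H B' hH] at this
  simp [Measure.real, this, ENNReal.toReal_mul]

lemma measurePreserving_update (ν : Measure X) [IsProbabilityMeasure ν] (i : ι) :
    MeasurePreserving (fun q : (ι → X) × X => Function.update q.1 i q.2)
      ((Measure.pi fun _ : ι => ν).prod ν) (Measure.pi fun _ : ι => ν) := by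
  have hm : Measurable (fun q : (ι → X) × X => Function.update q.1 i q.2) := by
    refine measurable_pi_lambda _ fun j => ?_
    by_cases h : j = i
    · subst h; simpa using measurable_snd
    · simp only [Function.update_of_ne h]
      exact (measurable_pi_apply j).comp measurable_fst
  refine ⟨hm, (Measure.pi_eq fun s hs => ?_).symm⟩
  rw [Measure.map_apply hm (.univ_pi hs)]
  have : (fun q : (ι → X) × X => Function.update q.1 i q.2) ⁻¹' Set.univ.pi s =
      (Set.univ.pi (Function.update s i Set.univ)) ×ˢ s i := by
    ext q
    simp only [Set.mem_preimage, Set.mem_pi, Set.mem_univ, true_imp_iff, Set.mem_prod]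
    constructor
    · intro h
      refine ⟨fun j => ?_, by simpa using h i⟩
      by_cases hj : j = i
      · subst hj; simp
      · simpa [Function.update_of_ne hj] using h j
    · rintro ⟨h, h'⟩ j
      by_cases hj : j = i
      · subst hj; simpa using h'
      · simpa [Function.update_of_ne hj] using h j
  rw [this, Measure.prod_prod, Measure.pi_pi, ← Finset.mul_prod_erase _ _ (Finset.mem_univ i),
    ← Finset.mul_prod_erase Finset.univ (fun j => ν (s j)) (Finset.mem_univ i)]
  simp only [Function.update_self, measure_univ, one_mul]
  rw [mul_comm]
  congr 1
  refine Finset.prod_congr rfl fun j hj => ?_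
  rw [Function.update_of_ne (Finset.ne_of_mem_erase hj)]

/-- Resampling one coordinate of a product measure. -/
lemma pi_apply_eq_lintegral_update (ν : Measure X) [IsProbabilityMeasure ν] (i : ι)
    {G : Set (ι → X)} (hG : MeasurableSet G) :
    (Measure.pi fun _ : ι => ν) G =
      ∫⁻ U, ν {x | Function.update U i x ∈ G} ∂(Measure.pi fun _ : ι => ν) := by
  have h := measurePreserving_update (ι := ι) ν i
  rw [← h.measure_preimage hG.nullMeasurableSet, Measure.prod_apply (h.measurable hG)]
  rfl

lemma measurePreserving_comp_perm {ι X : Type*} [Fintype ι] [MeasurableSpace X] (ν : Measure X) [IsProbabilityMeasure ν] (σ : Equiv.Perm ι) :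
    MeasurePreserving (fun (U : ι → X) i => U (σ i))
      (Measure.pi fun _ : ι => ν) (Measure.pi fun _ : ι => ν) := by
  have := measurePreserving_piCongrLeft (fun _ : ι => ν) σ.symm
  have h : (fun (U : ι → X) i => U (σ i)) =
      MeasurableEquiv.piCongrLeft (fun _ : ι => X) σ.symm := by
    funext U i
    have := Equiv.piCongrLeft_apply_apply (fun _ : ι => X) σ.symm U (σ i)
    simp only [Equiv.symm_apply_apply] at this
    exact this.symm
  rw [h]
  exact this

end Product

/-! ### Location of maxima of i.i.d. variables -/

section Exchangeable

/-- The coordinate `x` is strictly larger than all other coordinates in `C`. -/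
def StrictMax {ι : Type*} (C : Finset ι) (x : ι) : Set (ι → ℝ) :=
  {u | ∀ c ∈ C, c ≠ x → u c < u x}

lemma measurableSet_strictMax {ι : Type*} [Countable ι] (C : Finset ι) (x : ι) :
    MeasurableSet (StrictMax C x) := by
  have : StrictMax C x = ⋂ c, ⋂ (_ : c ∈ C), ⋂ (_ : c ≠ x), {u : ι → ℝ | u c < u x} := by
    ext u; simp [StrictMax]
  rw [this]
  refine MeasurableSet.iInter fun c => MeasurableSet.iInter fun _ => MeasurableSet.iInter fun _ => ?_
  exact measurableSet_lt (measurable_pi_apply c) (measurable_pi_apply x)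

lemma strictMax_perm {ι : Type*} {C : Finset ι} (σ : Equiv.Perm ι) (hσ : ∀ c, σ c ∈ C ↔ c ∈ C)
    (z : ι) : (fun (u : ι → ℝ) i => u (σ i)) ⁻¹' StrictMax C z = StrictMax C (σ z) := by
  ext u
  simp only [StrictMax, Set.mem_preimage, Set.mem_ofPred_eq]
  constructor
  · intro h c hc hcz
    have := h (σ.symm c) (by rw [← hσ]; simpa using hc) (by
      rintro rfl; simp at hcz)
    simpa using this
  · intro h c hc hcz
    exact h _ ((hσ c).2 hc) (fun h' => hcz (σ.injective h'))

lemma swap_mem_iff {ι : Type*} [DecidableEq ι] {C : Finset ι} {x y : ι} (hx : x ∈ C) (hy : y ∈ C)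
    (c : ι) : Equiv.swap x y c ∈ C ↔ c ∈ C := by
  rw [Equiv.swap_apply_def]
  split_ifs with h1 h2
  · simp [h1, hx, hy]
  · simp [h2, hx, hy]
  · rfl

lemma strictMax_disjoint {ι : Type*} {C : Finset ι} {x y : ι} (hx : x ∈ C) (hy : y ∈ C)
    (hxy : x ≠ y) : Disjoint (StrictMax C x) (StrictMax C y) := by
  rw [Set.disjoint_left]
  intro u h1 h2
  exact lt_asymm (h1 y hy hxy.symm) (h2 x hx hxy)

/-- One of `#C` equally likely disjoint events contained in `Q`. -/
lemma real_le_div_card {Ω α : Type*} [MeasurableSpace Ω] (μ : Measure Ω) [IsFiniteMeasure μ]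
    (C : Finset α) (G : α → Set Ω) (Q : Set Ω) {x : α} (hx : x ∈ C)
    (hm : ∀ y ∈ C, MeasurableSet (G y))
    (hd : ∀ y ∈ C, ∀ z ∈ C, y ≠ z → Disjoint (G y) (G z)) (hQ : ∀ y ∈ C, G y ⊆ Q)
    (he : ∀ y ∈ C, μ.real (G y) = μ.real (G x)) :
    μ.real (G x) ≤ μ.real Q / C.card := by
  have hpos : (0 : ℝ) < C.card := by exact_mod_cast Finset.card_pos.2 ⟨x, hx⟩
  rw [le_div_iff₀ hpos]
  have h1 : μ.real (⋃ y ∈ C, G y) = ∑ y ∈ C, μ.real (G y) :=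
    measureReal_biUnion_finset (fun y hy z hz hyz => hd y hy z hz hyz) hm
  rw [Finset.sum_congr rfl he, Finset.sum_const, nsmul_eq_mul, mul_comm] at h1
  rw [← h1]
  exact measureReal_mono (by simpa using hQ)

variable {ι : Type*} [Fintype ι] [DecidableEq ι]

lemma pi_strictMax_le (ν : Measure ℝ) [IsProbabilityMeasure ν] {C : Finset ι} {x : ι}
    (hx : x ∈ C) : (Measure.pi fun _ : ι => ν).real (StrictMax C x) ≤ 1 / C.card := by
  refine (real_le_div_card (Measure.pi fun _ : ι => ν) C (StrictMax C) Set.univ hx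
    (fun y _ => measurableSet_strictMax C y) (fun y hy z hz h => strictMax_disjoint hy hz h)
    (fun _ _ => Set.subset_univ _) ?_).trans (by simp)
  intro y hy
  have h := (measurePreserving_comp_perm ν (Equiv.swap x y)).measureReal_preimage
    (measurableSet_strictMax C x).nullMeasurableSet
  rwa [strictMax_perm _ (swap_mem_iff hx hy), Equiv.swap_apply_left] at h

/-- Transposing two elements of `Y` fixes `z` and preserves `W`. So, on the event that `z` wins in
`W`, all elements of `Y` are equally likely to be the runner-up within `Y`. -/
lemma pi_strictMax_inter_le (ν : Measure ℝ) [IsProbabilityMeasure ν] {W Y : Finset ι} {x z : ι}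
    (hz : z ∈ W) (hx : x ∈ Y) (hzY : z ∉ Y) (hYW : Y ⊆ W) :
    (Measure.pi fun _ : ι => ν).real (StrictMax W z ∩ StrictMax Y x) ≤
      1 / (W.card * Y.card) := by
  have := real_le_div_card (Measure.pi fun _ : ι => ν) Y (fun y => StrictMax W z ∩ StrictMax Y y)
    (StrictMax W z) hx
    (fun y _ => (measurableSet_strictMax W z).inter (measurableSet_strictMax Y y))
    (fun y hy w hw h => (strictMax_disjoint hy hw h).mono Set.inter_subset_right
      Set.inter_subset_right)
    (fun _ _ => Set.inter_subset_left) ?_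
  · refine this.trans ?_
    rw [← div_div]
    gcongr
    exact pi_strictMax_le ν hz
  intro y hy
  have h := (measurePreserving_comp_perm ν (Equiv.swap x y)).measureReal_preimage
    ((measurableSet_strictMax W z).inter (measurableSet_strictMax Y x)).nullMeasurableSet
  rw [Set.preimage_inter, strictMax_perm _ (swap_mem_iff hx hy), Equiv.swap_apply_left,
    strictMax_perm _ (swap_mem_iff (hYW hx) (hYW hy)), Equiv.swap_apply_of_ne_of_ne
      (ne_of_mem_of_not_mem hx hzY).symm (ne_of_mem_of_not_mem hy hzY).symm] at h
  exact h

end Exchangeable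

/-! ### Payoff law: marginals, common payoffs and the two-step block -/

section Payoffs

instance : IsProbabilityMeasure unif := ⟨by simp [unif]⟩

instance : NullSingletonClass unif := by unfold unif; infer_instance

lemma isProbabilityMeasure_payoffLaw {p : ℝ} (hp0 : 0 < p) (hp1 : p ≤ 1) :
    IsProbabilityMeasure (payoffLaw p) := by
  have : IsProbabilityMeasure (unif.map (fun x => (x, x))) :=
    Measure.isProbabilityMeasure_map (by fun_prop)
  refine ⟨?_⟩
  simp only [payoffLaw, Measure.add_apply, Measure.smul_apply, measure_univ, smul_eq_mul, mul_one]
  rw [← ENNReal.ofReal_add hp0.le (by linarith)]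
  simp

/-- The payoff of player A (`e = true`) or player B (`e = false`). -/
def payoff (e : Bool) (x : ℝ × ℝ) : ℝ := if e then x.1 else x.2

lemma measurable_payoff (e : Bool) : Measurable (payoff e) := by
  cases e
  · exact measurable_snd
  · exact measurable_fst

/-- The diagonal is null for the independent component, so equality of the two payoffs identifies
the common component of the mixture almost surely. -/
lemma payoffLaw_common {p : ℝ} (e : Bool) {B : Set ℝ} (hB : MeasurableSet B) :
    payoffLaw p ({x | x.1 = x.2} ∩ payoff e ⁻¹' B) = ENNReal.ofReal p * unif B := by
  have hd : MeasurableSet {x : ℝ × ℝ | x.1 = x.2} :=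
    measurableSet_eq_fun measurable_fst measurable_snd
  have hm := hd.inter (measurable_payoff e hB)
  have h0 : (unif.prod unif) {x : ℝ × ℝ | x.1 = x.2} = 0 := by
    rw [Measure.prod_apply hd]
    simp [Set.preimage]
  simp only [payoffLaw, Measure.add_apply, Measure.smul_apply, smul_eq_mul]
  rw [measure_mono_null Set.inter_subset_left h0, mul_zero, add_zero,
    Measure.map_apply (by fun_prop) hm]
  congr 2
  ext x
  cases e <;> simp [payoff]

lemma measurePreserving_payoff {p : ℝ} (hp0 : 0 < p) (hp1 : p ≤ 1) (e : Bool) :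
    MeasurePreserving (payoff e) (payoffLaw p) unif := by
  refine ⟨measurable_payoff e, ?_⟩
  have h1 : (unif.map (fun x => (x, x))).map (payoff e) = unif := by
    rw [Measure.map_map (measurable_payoff e) (by fun_prop)]
    have : payoff e ∘ (fun x : ℝ => (x, x)) = id := by
      funext x; cases e <;> simp [payoff]
    rw [this, Measure.map_id]
  have h2 : (unif.prod unif).map (payoff e) = unif := by
    cases e
    · exact Measure.snd_prod
    · exact Measure.fst_prod
  rw [payoffLaw, Measure.map_add _ _ (measurable_payoff e), Measure.map_smul, Measure.map_smul,
    h1, h2, ← add_smul, ← ENNReal.ofReal_add hp0.le (by linarith)]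
  simp

variable {ι : Type*} [Fintype ι] [DecidableEq ι]

/-- One chosen payoff of every cell. -/
def values {ι : Type*} (E : ι → Bool) (U : ι → ℝ × ℝ) : ι → ℝ := fun c => payoff (E c) (U c)

lemma measurePreserving_values {ι : Type*} [Fintype ι] {p : ℝ} (hp0 : 0 < p) (hp1 : p ≤ 1)
    (E : ι → Bool) :
    MeasurePreserving (values E) (Measure.pi fun _ : ι => payoffLaw p)
      (Measure.pi fun _ : ι => unif) :=
  measurePreserving_pi (fun _ : ι => payoffLaw p) (fun _ : ι => unif)
    (fun i => measurePreserving_payoff hp0 hp1 (E i))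

lemma pi_payoff_eq_null {p : ℝ} (hp0 : 0 < p) (hp1 : p ≤ 1) (e : Bool) {c c' : ι} (h : c ≠ c') :
    (Measure.pi fun _ : ι => payoffLaw p) {U | payoff e (U c) = payoff e (U c')} = 0 := by
  have hm : MeasurableSet {u : ι → ℝ | u c = u c'} :=
    measurableSet_eq_fun (measurable_pi_apply c) (measurable_pi_apply c')
  have := (measurePreserving_values hp0 hp1 (fun _ : ι => e)).measure_preimage hm.nullMeasurableSet
  change (Measure.pi fun _ : ι => payoffLaw p) (values (fun _ => e) ⁻¹' {u | u c = u c'}) = 0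
  rw [this, pi_apply_eq_lintegral_update unif c hm]
  simp [Function.update_of_ne h.symm]

/-- Either payoff is uniform under both components of the mixture, so coincidence at `c` is
independent of the field `values E`. Resampling the single cell `c` reduces this to
`payoffLaw_common`. -/
lemma pi_common_inter {p : ℝ} (hp0 : 0 < p) (hp1 : p ≤ 1) (E : ι → Bool) (c : ι)
    {G : Set (ι → ℝ)} (hG : MeasurableSet G) :
    (Measure.pi fun _ : ι => payoffLaw p) ({U | (U c).1 = (U c).2} ∩ values E ⁻¹' G) =
      ENNReal.ofReal p * (Measure.pi fun _ : ι => unif) G := by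
  have := isProbabilityMeasure_payoffLaw hp0 hp1
  have hv := measurePreserving_values hp0 hp1 E
  have hd : MeasurableSet {U : ι → ℝ × ℝ | (U c).1 = (U c).2} :=
    measurableSet_eq_fun (measurable_pi_apply c).fst (measurable_pi_apply c).snd
  have hupd : ∀ u : ι → ℝ, Measurable (fun y : ℝ => Function.update u c y) := by
    intro u; exact measurable_update u
  have hmeas : Measurable fun u : ι → ℝ => unif {y | Function.update u c y ∈ G} :=
    measurable_measure_prodMk_left ((measurePreserving_update unif c).measurable hG)
  rw [pi_apply_eq_lintegral_update _ c (hd.inter (hv.measurable hG)),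
    pi_apply_eq_lintegral_update _ c hG, ← hv.lintegral_comp hmeas,
    ← lintegral_const_mul _ (f := fun U => unif {y | Function.update (values E U) c y ∈ G})
      (hmeas.comp hv.measurable)]
  congr 1
  funext U
  have hB : MeasurableSet {y | Function.update (values E U) c y ∈ G} := hupd _ hG
  rw [← payoffLaw_common (E c) hB]
  congr 1
  ext x
  have : values E (Function.update U c x) = Function.update (values E U) c (payoff (E c) x) := by
    funext i
    by_cases hi : i = c
    · subst hi; simp [values]
    · simp [values, Function.update_of_ne hi]
  simp [this]

/-- Among the cells of `C`, the cell `x` gives player `e` the strictly largest payoff. -/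
def Beats {ι : Type*} (e : Bool) (C : Finset ι) (x : ι) : Set (ι → ℝ × ℝ) :=
  {U | ∀ c ∈ C, c ≠ x → payoff e (U c) < payoff e (U x)}

lemma beats_eq_values {ι : Type*} (E : ι → Bool) {e : Bool} {C : Finset ι} {x : ι} (hx : x ∈ C)
    (hE : ∀ c ∈ C, E c = e) : Beats e C x = values E ⁻¹' StrictMax C x := by
  ext U
  simp only [Beats, StrictMax, values, Set.mem_preimage, Set.mem_ofPred_eq, hE x hx]
  refine forall₂_congr fun c hc => ?_
  rw [hE c hc]

lemma measurableSet_beats {ι : Type*} [Countable ι] (e : Bool) {C : Finset ι} {x : ι}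
    (hx : x ∈ C) : MeasurableSet (Beats e C x) := by
  rw [beats_eq_values (fun _ => e) hx (fun _ _ => rfl)]
  refine measurableSet_preimage ?_ (measurableSet_strictMax C x)
  exact measurable_pi_lambda _ fun i => (measurable_payoff e).comp (measurable_pi_apply i)

lemma determinedBy_beats {ι : Type*} (e : Bool) {C : Finset ι} {x : ι} (hx : x ∈ C) :
    DeterminedBy (Beats e C x) C := by
  intro U V hUV hU c hc hcx
  rw [← hUV c hc, ← hUV x hx]
  exact hU c hc hcx

lemma determinedBy_strictMax {ι : Type*} {C : Finset ι} {x : ι} (hx : x ∈ C) :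
    DeterminedBy (StrictMax C x) C := by
  intro U V hUV hU c hc hcx
  rw [← hUV c hc, ← hUV x hx]
  exact hU c hc hcx

lemma pi_beats_le {p : ℝ} (hp0 : 0 < p) (hp1 : p ≤ 1) (e : Bool) {C : Finset ι} {x : ι}
    (hx : x ∈ C) : (Measure.pi fun _ : ι => payoffLaw p).real (Beats e C x) ≤ 1 / C.card := by
  rw [beats_eq_values (fun _ => e) hx (fun _ _ => rfl),
    (measurePreserving_values hp0 hp1 _).measureReal_preimage
      (measurableSet_strictMax C x).nullMeasurableSet]
  exact pi_strictMax_le unif hx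

/-- The fresh maximum is beaten by one further cell. -/
lemma pi_beats_inter_lt_le {p : ℝ} (hp0 : 0 < p) (hp1 : p ≤ 1) (e : Bool) {C : Finset ι} {x d : ι}
    (hx : x ∈ C) (hd : d ∉ C) :
    (Measure.pi fun _ : ι => payoffLaw p).real
      (Beats e C x ∩ {U | payoff e (U x) < payoff e (U d)}) ≤
        1 / ((C.card + 1) * C.card) := by
  have := isProbabilityMeasure_payoffLaw hp0 hp1
  have h := pi_strictMax_inter_le unif (Finset.mem_insert_self d C) hx hd (Finset.subset_insert d C)
  rw [Finset.card_insert_of_notMem hd] at h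
  push_cast at h
  refine le_trans ?_ h
  rw [← (measurePreserving_values hp0 hp1 (fun _ => e)).measureReal_preimage
    ((measurableSet_strictMax _ d).inter (measurableSet_strictMax C x)).nullMeasurableSet]
  refine measureReal_mono ?_
  rintro U ⟨hU, hlt⟩
  refine ⟨?_, fun c hc hcx => hU c hc hcx⟩
  intro c hc hcd
  have hcC := Finset.mem_of_mem_insert_of_ne hc hcd
  by_cases hcx : c = x
  · subst hcx; exact hlt
  · exact (hU c hcC hcx).trans hlt

/-- Two consecutive exploration steps after which the pivot `x` was not an equilibrium. -/
lemma pi_block_le {p : ℝ} (hp0 : 0 < p) (hp1 : p ≤ 1) (e : Bool) {C D : Finset ι} {x z : ι}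
    (hx : x ∈ C) (hz : z ∈ D) (hCD : Disjoint C D) (hcard : D.card ≤ C.card) :
    (Measure.pi fun _ : ι => payoffLaw p).real
      (Beats e C x ∩ Beats (!e) D z ∩ {U | payoff (!e) (U x) < payoff (!e) (U z)}) ≤
        (1 - p / 2) * (1 / C.card * (1 / D.card)) := by
  have := isProbabilityMeasure_payoffLaw hp0 hp1
  set μ := Measure.pi fun _ : ι => payoffLaw p
  set ρ := Measure.pi fun _ : ι => unif
  -- Reading each cell through the player who inspects it turns both selections into statements
  -- about one field of i.i.d. uniforms.
  let E : ι → Bool := fun c => if c ∈ C then e else !e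
  have hzC : z ∉ C := fun h => Finset.disjoint_left.1 hCD h hz
  have hEC : ∀ c ∈ C, E c = e := fun c hc => by simp [E, hc]
  have hED : ∀ c ∈ D, E c = !e := fun c hc => by
    simp [E, Finset.disjoint_right.1 hCD hc]
  have hv := measurePreserving_values hp0 hp1 E
  let common : Set (ι → ℝ × ℝ) := {U | (U x).1 = (U x).2}
  have hcm : MeasurableSet common :=
    measurableSet_eq_fun (measurable_pi_apply x).fst (measurable_pi_apply x).snd
  let G : Set (ι → ℝ) := StrictMax C x ∩ StrictMax D z
  let H : Set (ι → ℝ) := StrictMax (C ∪ D) z ∩ StrictMax C x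
  have hGm : MeasurableSet G := (measurableSet_strictMax C x).inter (measurableSet_strictMax D z)
  have hHm : MeasurableSet H := (measurableSet_strictMax _ z).inter (measurableSet_strictMax C x)
  have hG : ρ.real G ≤ 1 / C.card * (1 / D.card) := by
    rw [pi_real_inter_of_disjoint unif (measurableSet_strictMax C x) (measurableSet_strictMax D z)
      (determinedBy_strictMax hx) (determinedBy_strictMax hz) hCD]
    exact mul_le_mul (pi_strictMax_le unif hx) (pi_strictMax_le unif hz) measureReal_nonneg
      (by positivity)
  have hH : ρ.real H ≤ 1 / ((C.card + D.card) * C.card) := by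
    have := pi_strictMax_inter_le unif (Finset.mem_union_right C hz) hx hzC
      (Finset.subset_union_left (s₂ := D))
    rw [Finset.card_union_of_disjoint hCD] at this
    exact_mod_cast this
  have hc : ∀ F : Set (ι → ℝ), MeasurableSet F →
      μ.real (common ∩ values E ⁻¹' F) = p * ρ.real F := by
    intro F hF
    have := pi_common_inter hp0 hp1 E x hF
    simp only [Measure.real, μ, ρ, common]
    rw [this, ENNReal.toReal_mul, ENNReal.toReal_ofReal hp0.le]
  have hsub : Beats e C x ∩ Beats (!e) D z ∩ {U | payoff (!e) (U x) < payoff (!e) (U z)} ⊆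
      (values E ⁻¹' G) \ common ∪ common ∩ values E ⁻¹' H := by
    rintro U ⟨⟨h1, h2⟩, h3⟩
    rw [beats_eq_values E hx hEC] at h1
    rw [beats_eq_values E hz hED] at h2
    by_cases hU : U ∈ common
    -- When the payoffs at `x` coincide, rejection compares `x` and `z` inside this same field, so
    -- `z` is the maximum of all of `C ∪ D`.
    · refine Or.inr ⟨hU, ?_, h1⟩
      have hxz : values E U x < values E U z := by
        have h3' : payoff (!e) (U x) < payoff (!e) (U z) := h3
        have : payoff (!e) (U x) = payoff e (U x) := by
          have hU' : (U x).1 = (U x).2 := hU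
          cases e <;> simp [payoff, hU']
        simpa [values, hEC x hx, hED z hz, this] using h3'
      intro c hc hcz
      rcases Finset.mem_union.1 hc with hc | hc
      · by_cases hcx : c = x
        · subst hcx; exact hxz
        · exact (h1 c hc hcx).trans hxz
      · exact h2 c hc hcz
    · exact Or.inl ⟨⟨h1, h2⟩, hU⟩
  have hdiff : μ.real ((values E ⁻¹' G) \ common) = (1 - p) * ρ.real G := by
    have h1 := measureReal_inter_add_sdiff (μ := μ) (s := values E ⁻¹' G) hcm
    rw [Set.inter_comm, hc G hGm, hv.measureReal_preimage hGm.nullMeasurableSet] at h1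
    linarith
  have hC0 : (0 : ℝ) < C.card := by exact_mod_cast Finset.card_pos.2 ⟨x, hx⟩
  have hD0 : (0 : ℝ) < D.card := by exact_mod_cast Finset.card_pos.2 ⟨z, hz⟩
  have hDC : (D.card : ℝ) ≤ C.card := by exact_mod_cast hcard
  -- The factor `1/2` comes from `#C + #D ≥ 2 * #D`; this is where `hcard` enters.
  have hH' : ρ.real H ≤ 1 / C.card * (1 / D.card) / 2 := by
    refine hH.trans ?_
    rw [div_mul_div_comm, div_div]
    rw [one_mul]
    refine one_div_le_one_div_of_le (by positivity) ?_
    nlinarith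
  calc _ ≤ μ.real ((values E ⁻¹' G) \ common ∪ common ∩ values E ⁻¹' H) := measureReal_mono hsub
    _ ≤ _ := measureReal_union_le _ _
    _ = (1 - p) * ρ.real G + p * ρ.real H := by rw [hdiff, hc H hHm]
    _ ≤ (1 - p) * (1 / C.card * (1 / D.card)) + p * (1 / C.card * (1 / D.card) / 2) := by
      have : 0 ≤ 1 - p := by linarith
      gcongr
    _ = _ := by ring

end Payoffs

/-! ### Abstract exploration of disjoint sets of cells -/

/-- A family of exploration steps `s` in disjoint sets of cells `C s`; in step `s` player `e s`
selects the cell `x s`. -/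
structure Exploration (ι κ : Type*) where
  C : κ → Finset ι
  x : κ → ι
  e : κ → Bool
  mem : ∀ s, x s ∈ C s
  disj : ∀ s t, s ≠ t → Disjoint (C s) (C t)

namespace Exploration

/-- The steps in `S` select the prescribed cells. -/
def event {ι κ : Type*} (X : Exploration ι κ) (S : Finset κ) : Set (ι → ℝ × ℝ) :=
  {U | ∀ s ∈ S, U ∈ Beats (X.e s) (X.C s) (X.x s)}

/-- The pivots selected in steps `q ∈ Q` are rejected in the step `nxt q`. -/
def rejects {ι κ : Type*} (X : Exploration ι κ) (nxt : κ → κ) (Q : Finset κ) :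
    Set (ι → ℝ × ℝ) :=
  {U | ∀ q ∈ Q, payoff (X.e (nxt q)) (U (X.x q)) < payoff (X.e (nxt q)) (U (X.x (nxt q)))}

lemma measurableSet_event {ι κ : Type*} [Countable ι] (X : Exploration ι κ) (S : Finset κ) :
    MeasurableSet (X.event S) := by
  have : X.event S = ⋂ s ∈ S, Beats (X.e s) (X.C s) (X.x s) := by
    ext U; simp [event]
  rw [this]
  exact Finset.measurableSet_biInter S fun s _ => measurableSet_beats _ (X.mem s)

lemma measurableSet_payoff_lt {ι : Type*} (e : Bool) (x z : ι) :
    MeasurableSet {U : ι → ℝ × ℝ | payoff e (U x) < payoff e (U z)} :=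
  measurableSet_lt ((measurable_payoff e).comp (measurable_pi_apply x))
    ((measurable_payoff e).comp (measurable_pi_apply z))

lemma measurableSet_rejects {ι κ : Type*} (X : Exploration ι κ) (nxt : κ → κ) (Q : Finset κ) :
    MeasurableSet (X.rejects nxt Q) := by
  have : X.rejects nxt Q = ⋂ q ∈ Q,
      {U | payoff (X.e (nxt q)) (U (X.x q)) < payoff (X.e (nxt q)) (U (X.x (nxt q)))} := by
    ext U; simp [rejects]
  rw [this]
  exact Finset.measurableSet_biInter Q fun q _ => measurableSet_payoff_lt _ _ _

lemma determinedBy_event {ι κ : Type*} [DecidableEq ι] (X : Exploration ι κ) (S : Finset κ) :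
    DeterminedBy (X.event S) (S.biUnion X.C) := by
  intro U V hUV hU s hs
  exact determinedBy_beats _ (X.mem s) U V
    (fun c hc => hUV c (Finset.mem_biUnion.2 ⟨s, hs, hc⟩)) (hU s hs)

lemma determinedBy_rejects {ι κ : Type*} [DecidableEq ι] (X : Exploration ι κ) (nxt : κ → κ) {S Q : Finset κ}
    (hQ : ∀ q ∈ Q, q ∈ S ∧ nxt q ∈ S) :
    DeterminedBy (X.rejects nxt Q) (S.biUnion X.C) := by
  intro U V hUV hU q hq
  have h := hU q hq
  rwa [hUV _ (Finset.mem_biUnion.2 ⟨q, (hQ q hq).1, X.mem q⟩),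
    hUV _ (Finset.mem_biUnion.2 ⟨nxt q, (hQ q hq).2, X.mem _⟩)] at h

lemma disjoint_biUnion {ι κ : Type*} [DecidableEq ι] (X : Exploration ι κ) {s : κ} {S : Finset κ} (hs : s ∉ S) :
    Disjoint (X.C s) (S.biUnion X.C) := by
  rw [Finset.disjoint_biUnion_right]
  exact fun t ht => X.disj s t (fun h => hs (h ▸ ht))

variable {ι κ : Type*} [Fintype ι] [DecidableEq ι] [DecidableEq κ]

lemma real_event_le {p : ℝ} (hp0 : 0 < p) (hp1 : p ≤ 1) (X : Exploration ι κ) (S : Finset κ) :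
    (Measure.pi fun _ : ι => payoffLaw p).real (X.event S) ≤ ∏ s ∈ S, (1 / ((X.C s).card : ℝ)) := by
  have := isProbabilityMeasure_payoffLaw hp0 hp1
  induction S using Finset.induction_on with
  | empty => simp
  | insert s S hs ih =>
    have hE : X.event (insert s S) = Beats (X.e s) (X.C s) (X.x s) ∩ X.event S := by
      ext U; simp [event]
    rw [hE, pi_real_inter_of_disjoint _ (measurableSet_beats _ (X.mem s))
      (X.measurableSet_event S) (determinedBy_beats _ (X.mem s)) (X.determinedBy_event S)
      (X.disjoint_biUnion hs), Finset.prod_insert hs]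
    exact mul_le_mul (pi_beats_le hp0 hp1 _ (X.mem s)) ih measureReal_nonneg (by positivity)

/-- Injectivity of `nxt` on `Q` and `nxt q ∉ Q` make the pairs `{q, nxt q}` disjoint, so they form
independent blocks, each estimated by `pi_block_le`; unpaired steps keep their trivial factor. -/
lemma real_event_inter_rejects_le {p : ℝ} (hp0 : 0 < p) (hp1 : p ≤ 1) (X : Exploration ι κ)
    (nxt : κ → κ) (S Q : Finset κ) (hQS : ∀ q ∈ Q, q ∈ S ∧ nxt q ∈ S)
    (hinj : Set.InjOn nxt Q) (hQ : ∀ q ∈ Q, nxt q ∉ Q) (he : ∀ q ∈ Q, X.e (nxt q) = !X.e q)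
    (hc : ∀ q ∈ Q, (X.C (nxt q)).card ≤ (X.C q).card) :
    (Measure.pi fun _ : ι => payoffLaw p).real (X.event S ∩ X.rejects nxt Q) ≤
      (1 - p / 2) ^ Q.card * ∏ s ∈ S, (1 / ((X.C s).card : ℝ)) := by
  have := isProbabilityMeasure_payoffLaw hp0 hp1
  induction Q using Finset.induction_on generalizing S with
  | empty => simpa [rejects] using X.real_event_le hp0 hp1 S
  | insert q Q hq ih =>
    have hqQ := Finset.mem_insert_self q Q
    obtain ⟨hqS, hnS⟩ := hQS q hqQ
    have hne : nxt q ≠ q := fun h => hQ q hqQ (by rw [h]; exact hqQ)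
    -- Both steps of the block leave `S`, which is why the induction generalizes over `S`.
    set S' := (S.erase q).erase (nxt q) with hS'
    have hsub : ∀ r ∈ Q, r ∈ S' ∧ nxt r ∈ S' := by
      intro r hr
      have hrq : r ≠ q := fun h => hq (h ▸ hr)
      have hr' : r ∈ insert q Q := Finset.mem_insert_of_mem hr
      refine ⟨?_, ?_⟩
      · refine Finset.mem_erase.2 ⟨fun h => hQ q hqQ (by rw [← h]; exact hr'), Finset.mem_erase.2
          ⟨hrq, (hQS r hr').1⟩⟩
      · refine Finset.mem_erase.2 ⟨fun h => hrq (hinj (by simpa using Or.inr hr) (by simp) h),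
          Finset.mem_erase.2 ⟨fun h => hQ r hr' (by rw [h]; exact hqQ), (hQS r hr').2⟩⟩
    have hins : ∀ r ∈ Q, r ∈ insert q Q := fun r hr => Finset.mem_insert_of_mem hr
    have ih' := ih S' hsub (hinj.mono (by simp))
      (fun r hr h => hQ r (hins r hr) (hins _ h))
      (fun r hr => he r (hins r hr))
      (fun r hr => hc r (hins r hr))
    set A : Set (ι → ℝ × ℝ) := Beats (X.e q) (X.C q) (X.x q) ∩
      Beats (!X.e q) (X.C (nxt q)) (X.x (nxt q)) ∩
        {U | payoff (!X.e q) (U (X.x q)) < payoff (!X.e q) (U (X.x (nxt q)))} with hA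
    have hAm : MeasurableSet A := ((measurableSet_beats _ (X.mem q)).inter
      (measurableSet_beats _ (X.mem _))).inter (measurableSet_payoff_lt _ _ _)
    have hAd : DeterminedBy A (X.C q ∪ X.C (nxt q)) := by
      refine (((determinedBy_beats _ (X.mem q)).mono Finset.subset_union_left).inter
        ((determinedBy_beats _ (X.mem _)).mono Finset.subset_union_right)).inter ?_
      intro U V hUV hU
      have h : payoff _ _ < payoff _ _ := hU
      rwa [hUV _ (Finset.mem_union_left _ (X.mem q)),
        hUV _ (Finset.mem_union_right _ (X.mem (nxt q)))] at h
    have hdisj : Disjoint (X.C q ∪ X.C (nxt q)) (S'.biUnion X.C) := by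
      refine Finset.disjoint_union_left.2 ⟨X.disjoint_biUnion ?_, X.disjoint_biUnion ?_⟩ <;>
        simp [hS']
    have hE : X.event S ∩ X.rejects nxt (insert q Q) ⊆
        A ∩ (X.event S' ∩ X.rejects nxt Q) := by
      rintro U ⟨h1, h2⟩
      have heq := he q hqQ
      refine ⟨⟨⟨h1 q hqS, heq ▸ h1 _ hnS⟩, ?_⟩, fun s hs => h1 s ?_,
        fun r hr => h2 r (hins r hr)⟩
      · have := h2 q hqQ
        rwa [heq] at this
      · exact Finset.mem_of_mem_erase (Finset.mem_of_mem_erase hs)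
    have hblock := pi_block_le hp0 hp1 (X.e q) (X.mem q) (X.mem (nxt q))
      (X.disj q (nxt q) hne.symm) (hc q hqQ)
    have hprod : ∏ s ∈ S, (1 / ((X.C s).card : ℝ)) =
        1 / ((X.C q).card : ℝ) * (1 / ((X.C (nxt q)).card : ℝ)) *
          ∏ s ∈ S', (1 / ((X.C s).card : ℝ)) := by
      rw [mul_assoc, Finset.mul_prod_erase (S.erase q) (fun s => 1 / ((X.C s).card : ℝ)) (Finset.mem_erase.2 ⟨hne, hnS⟩),
        Finset.mul_prod_erase S (fun s => 1 / ((X.C s).card : ℝ)) hqS]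
    calc _ ≤ _ := measureReal_mono hE
      _ = _ := pi_real_inter_of_disjoint _ hAm
        ((X.measurableSet_event S').inter (X.measurableSet_rejects nxt Q)) hAd
        ((X.determinedBy_event S').inter (X.determinedBy_rejects nxt hsub)) hdisj
      _ ≤ _ := mul_le_mul hblock ih' measureReal_nonneg
        (mul_nonneg (by linarith) (by positivity))
      _ = _ := by
        rw [hprod, Finset.card_insert_of_notMem hq, pow_succ]
        ring

/-- Remove the cell `d` from all exploration steps. -/
def eraseCell {ι κ : Type*} [DecidableEq ι] (X : Exploration ι κ) (d : ι) (hd : ∀ s, d ≠ X.x s) : Exploration ι κ where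
  C s := (X.C s).erase d
  x := X.x
  e := X.e
  mem s := Finset.mem_erase.2 ⟨(hd s).symm, X.mem s⟩
  disj s t h := (X.disj s t h).mono (Finset.erase_subset _ _) (Finset.erase_subset _ _)

/-- By disjointness `d` lies in at most one set, whose size `c ≥ 2` drops to `c - 1 ≥ c / 2`. -/
lemma prod_eraseCell_le {ι κ : Type*} [DecidableEq ι] [DecidableEq κ] (X : Exploration ι κ) (d : ι) (hd : ∀ s, d ≠ X.x s) (S : Finset κ)
    (h2 : ∀ s, d ∈ X.C s → 2 ≤ (X.C s).card) :
    ∏ s ∈ S, (1 / (((X.eraseCell d hd).C s).card : ℝ)) ≤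
      2 * ∏ s ∈ S, (1 / ((X.C s).card : ℝ)) := by
  by_cases h : ∃ r ∈ S, d ∈ X.C r
  · obtain ⟨r, hr, hdr⟩ := h
    rw [← Finset.mul_prod_erase S _ hr, ← Finset.mul_prod_erase S _ hr, ← mul_assoc]
    have hrest : ∏ s ∈ S.erase r, (1 / (((X.eraseCell d hd).C s).card : ℝ)) =
        ∏ s ∈ S.erase r, (1 / ((X.C s).card : ℝ)) := by
      refine Finset.prod_congr rfl fun s hs => ?_
      have : d ∉ X.C s := fun h =>
        Finset.disjoint_left.1 (X.disj r s (Finset.ne_of_mem_erase hs).symm) hdr h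
      simp [eraseCell, Finset.erase_eq_of_notMem this]
    rw [hrest]
    refine mul_le_mul_of_nonneg_right ?_ (Finset.prod_nonneg fun _ _ => by positivity)
    have h2r : (2 : ℝ) ≤ (X.C r).card := by exact_mod_cast h2 r hdr
    have hcard : (((X.eraseCell d hd).C r).card : ℝ) = (X.C r).card - 1 := by
      have := Finset.card_erase_add_one hdr
      simp only [eraseCell]
      rw [eq_sub_iff_add_eq]
      exact_mod_cast this
    rw [hcard, mul_one_div, div_le_div_iff₀ (by linarith) (by linarith)]
    linarith
  · push Not at h
    have hrest : ∏ s ∈ S, (1 / (((X.eraseCell d hd).C s).card : ℝ)) =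
        ∏ s ∈ S, (1 / ((X.C s).card : ℝ)) := by
      refine Finset.prod_congr rfl fun s hs => ?_
      simp [eraseCell, Finset.erase_eq_of_notMem (h s hs)]
    rw [hrest]
    have : 0 ≤ ∏ s ∈ S, (1 / ((X.C s).card : ℝ)) := Finset.prod_nonneg fun _ _ => by positivity
    linarith

/-- A prescribed cell `d` outside `C s` beats the selection of step `s`. -/
lemma real_event_inter_lt_le {p : ℝ} (hp0 : 0 < p) (hp1 : p ≤ 1) (X : Exploration ι κ)
    (S : Finset κ) {s : κ} (hs : s ∈ S) {d : ι} (hds : d ∉ X.C s) (hd : ∀ s, d ≠ X.x s)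
    (h2 : ∀ s, d ∈ X.C s → 2 ≤ (X.C s).card) :
    (Measure.pi fun _ : ι => payoffLaw p).real
      (X.event S ∩ {U | payoff (X.e s) (U (X.x s)) < payoff (X.e s) (U d)}) ≤
        2 / ((X.C s).card + 1) * ∏ s ∈ S, (1 / ((X.C s).card : ℝ)) := by
  have := isProbabilityMeasure_payoffLaw hp0 hp1
  set Y := X.eraseCell d hd
  set A : Set (ι → ℝ × ℝ) := Beats (X.e s) (X.C s) (X.x s) ∩
    {U | payoff (X.e s) (U (X.x s)) < payoff (X.e s) (U d)}
  have hAm : MeasurableSet A :=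
    (measurableSet_beats _ (X.mem s)).inter (measurableSet_payoff_lt _ _ _)
  have hAd : DeterminedBy A (insert d (X.C s)) := by
    refine ((determinedBy_beats _ (X.mem s)).mono (Finset.subset_insert _ _)).inter ?_
    intro U V hUV hU
    have h : payoff _ _ < payoff _ _ := hU
    rwa [hUV _ (Finset.mem_insert_of_mem (X.mem s)), hUV _ (Finset.mem_insert_self _ _)] at h
  have hdisj : Disjoint (insert d (X.C s)) ((S.erase s).biUnion Y.C) := by
    rw [Finset.disjoint_insert_left, Finset.disjoint_biUnion_right]
    refine ⟨by simp [Y, eraseCell], fun t ht => ?_⟩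
    exact (X.disj s t (Finset.ne_of_mem_erase ht).symm).mono_right (Finset.erase_subset _ _)
  -- The cell `d` may be inspected in another step, which would destroy independence. Forgetting it
  -- there only enlarges the event, at the cost of the factor `2`.
  have hE : X.event S ∩ {U | payoff (X.e s) (U (X.x s)) < payoff (X.e s) (U d)} ⊆
      A ∩ Y.event (S.erase s) := by
    rintro U ⟨h1, h2⟩
    exact ⟨⟨h1 s hs, h2⟩, fun r hr c hc hcx => h1 r (Finset.mem_of_mem_erase hr) c
      (Finset.mem_of_mem_erase hc) hcx⟩
  calc _ ≤ _ := measureReal_mono hE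
    _ = _ := pi_real_inter_of_disjoint _ hAm (Y.measurableSet_event _) hAd
      (Y.determinedBy_event _) hdisj
    _ ≤ 1 / (((X.C s).card + 1) * (X.C s).card) *
        (2 * ∏ s ∈ S.erase s, (1 / ((X.C s).card : ℝ))) :=
      mul_le_mul (pi_beats_inter_lt_le hp0 hp1 _ (X.mem s) hds)
        ((Y.real_event_le hp0 hp1 _).trans (X.prod_eraseCell_le d hd _ h2)) measureReal_nonneg
        (by positivity)
    _ = _ := by
      rw [← Finset.mul_prod_erase S _ hs, ← one_div_mul_one_div]
      ring

end Exploration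

/-! ### Fresh paths and their coupling with the best response dynamics -/

section Dynamics

/-- No ties among the payoffs which are compared in a best response. -/
def NoTies {m k : ℕ} (U : Game m k) : Prop :=
  (∀ b, Function.Injective fun a => (U (a, b)).1) ∧ (∀ a, Function.Injective fun b => (U (a, b)).2)

/-- Alternating greedy responses restricted to actions which have not been used before. -/
structure IsFreshPath {m k : ℕ} (U : Game m k) (a : ℕ → Fin m) (b : ℕ → Fin k) (T : ℕ) : Prop where
  injA : Set.InjOn a (Set.Iic T)
  injB : Set.InjOn b (Set.Iic T)
  col : ∀ j < T, ∀ x, (∀ i ≤ j, x ≠ a i) → x ≠ a (j + 1) →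
    (U (x, b j)).1 < (U (a (j + 1), b j)).1
  row : ∀ j < T, ∀ y, (∀ i ≤ j, y ≠ b i) → y ≠ b (j + 1) →
    (U (a (j + 1), y)).2 < (U (a (j + 1), b (j + 1))).2

lemma exists_fresh_max {n T : ℕ} (hT : T + 1 < n) (a : ℕ → Fin n) {f : Fin n → ℝ}
    (hf : Function.Injective f) :
    ∃ x, (∀ i ≤ T, x ≠ a i) ∧ ∀ y, (∀ i ≤ T, y ≠ a i) → y ≠ x → f y < f x := by
  classical
  let S : Finset (Fin n) := Finset.univ \ (Finset.range (T + 1)).image a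
  have hS : S.Nonempty := by
    rw [← Finset.card_pos, Finset.card_sdiff_of_subset (Finset.subset_univ _)]
    have : ((Finset.range (T + 1)).image a).card ≤ T + 1 :=
      Finset.card_image_le.trans (by simp)
    simp only [Finset.card_univ, Fintype.card_fin]
    omega
  have hmem : ∀ x, x ∈ S ↔ ∀ i ≤ T, x ≠ a i := by
    intro x
    simp only [S, Finset.mem_sdiff, Finset.mem_univ, true_and, Finset.mem_image, Finset.mem_range,
      not_exists, not_and]
    exact ⟨fun h i hi h' => h i (by omega) h'.symm, fun h i hi h' => h i (by omega) h'.symm⟩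
  obtain ⟨x, hx, hmax⟩ := S.exists_max_image f hS
  refine ⟨x, (hmem x).1 hx, fun y hy hyx => ?_⟩
  exact lt_of_le_of_ne (hmax y ((hmem y).2 hy)) (fun h => hyx (hf h))

lemma injOn_update_succ {α : Type*} {T : ℕ} {a : ℕ → α} (ha : Set.InjOn a (Set.Iic T)) {x : α}
    (hx : ∀ i ≤ T, x ≠ a i) : Set.InjOn (Function.update a (T + 1) x) (Set.Iic (T + 1)) := by
  intro i hi j hj hij
  simp only [Set.mem_Iic] at hi hj
  by_cases h1 : i = T + 1 <;> by_cases h2 : j = T + 1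
  · omega
  · subst h1
    rw [Function.update_self, Function.update_of_ne h2] at hij
    exact absurd hij (hx j (by omega))
  · subst h2
    rw [Function.update_self, Function.update_of_ne h1] at hij
    exact absurd hij.symm (hx i (by omega))
  · rw [Function.update_of_ne h1, Function.update_of_ne h2] at hij
    exact ha (by simp; omega) (by simp; omega) hij

lemma exists_isFreshPath {m k : ℕ} {U : Game m k} (hU : NoTies U) (s : Profile m k) (T : ℕ)
    (hm : T < m) (hk : T < k) :
    ∃ (a : ℕ → Fin m) (b : ℕ → Fin k), a 0 = s.1 ∧ b 0 = s.2 ∧ IsFreshPath U a b T := by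
  induction T with
  | zero =>
    refine ⟨fun _ => s.1, fun _ => s.2, rfl, rfl, ?_, ?_, by simp, by simp⟩ <;>
    · intro i hi j hj _
      simp only [Set.mem_Iic] at hi hj
      omega
  | succ T ih =>
    obtain ⟨a, b, ha0, hb0, h⟩ := ih (by omega) (by omega)
    obtain ⟨x, hx, hxmax⟩ := exists_fresh_max hm a (hU.1 (b T))
    obtain ⟨y, hy, hymax⟩ := exists_fresh_max hk b (hU.2 x)
    refine ⟨Function.update a (T + 1) x, Function.update b (T + 1) y, by simpa using ha0,
      by simpa using hb0, injOn_update_succ h.injA hx, injOn_update_succ h.injB hy, ?_, ?_⟩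
    · intro j hj z hz hz'
      have hz2 : ∀ i ≤ j, z ≠ a i := fun i hi => by
        have := hz i hi
        rwa [Function.update_of_ne (by omega)] at this
      rw [Function.update_of_ne (show j ≠ T + 1 by omega)]
      rcases Nat.lt_succ_iff_lt_or_eq.1 hj with hj' | rfl
      · rw [Function.update_of_ne (by omega)] at hz' ⊢
        exact h.col j hj' z hz2 hz'
      · rw [Function.update_self] at hz' ⊢
        exact hxmax z hz2 hz'
    · intro j hj z hz hz'
      have hz2 : ∀ i ≤ j, z ≠ b i := fun i hi => by
        have := hz i hi
        rwa [Function.update_of_ne (by omega)] at this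
      rcases Nat.lt_succ_iff_lt_or_eq.1 hj with hj' | rfl
      · rw [Function.update_of_ne (show j + 1 ≠ T + 1 by omega)] at hz' ⊢
        rw [Function.update_of_ne (show j + 1 ≠ T + 1 by omega)]
        exact h.row j hj' z hz2 hz'
      · rw [Function.update_self] at hz' ⊢
        rw [Function.update_self]
        exact hymax z hz2 hz'

lemma respond_eq {n : ℕ} {S : Finset (Fin n)} {x y : Fin n} (hS : S = {y}) (h : x ≠ y) :
    respond S x = y := by
  have hS' : S \ {x} = {y} := by
    subst hS
    ext z
    simp only [Finset.mem_sdiff, Finset.mem_singleton]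
    exact ⟨fun hz => hz.1, fun hz => ⟨hz, by rw [hz]; exact h.symm⟩⟩
  unfold respond
  rw [dif_pos (by rw [hS']; simp)]
  simp [hS']

lemma argmaxA_eq {m k : ℕ} {U : Game m k} {b : Fin k} {x : Fin m}
    (h : ∀ z, z ≠ x → (U (z, b)).1 < (U (x, b)).1) : argmaxA U b = {x} := by
  ext z
  simp only [argmaxA, Finset.mem_filter, Finset.mem_univ, true_and, Finset.mem_singleton]
  constructor
  · intro hz
    by_contra hzx
    exact absurd (hz x) (not_le.2 (h z hzx))
  · rintro rfl w
    by_cases hw : w = z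
    · rw [hw]
    · exact (h w hw).le

lemma argmaxB_eq {m k : ℕ} {U : Game m k} {a : Fin m} {y : Fin k}
    (h : ∀ z, z ≠ y → (U (a, z)).2 < (U (a, y)).2) : argmaxB U a = {y} := by
  ext z
  simp only [argmaxB, Finset.mem_filter, Finset.mem_univ, true_and, Finset.mem_singleton]
  constructor
  · intro hz
    by_contra hzx
    exact absurd (hz y) (not_le.2 (h z hzx))
  · rintro rfl w
    by_cases hw : w = z
    · rw [hw]
    · exact (h w hw).le

lemma brd_even_succ {m k : ℕ} (U : Game m k) (s : Profile m k) (j : ℕ) :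
    brd U s (2 * j + 1) =
      (respond (argmaxA U (brd U s (2 * j)).2) (brd U s (2 * j)).1, (brd U s (2 * j)).2) := by
  simp [brd]

lemma brd_odd_succ {m k : ℕ} (U : Game m k) (s : Profile m k) (j : ℕ) :
    brd U s (2 * j + 2) = ((brd U s (2 * j + 1)).1,
      respond (argmaxB U (brd U s (2 * j + 1)).1) (brd U s (2 * j + 1)).2) := by
  rw [brd]
  simp

/-- As long as no previously used action interferes, the best response dynamics follows the fresh
path, and every pivot before an equilibrium is reached is rejected. -/
lemma IsFreshPath.follow {m k : ℕ} {U : Game m k} {a : ℕ → Fin m} {b : ℕ → Fin k} {T : ℕ}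
    (h : IsFreshPath U a b T) (hU : NoTies U)
    (hA : ∀ j < T, ∀ i, (i < j ∨ i = 0) → (U (a i, b j)).1 ≤ (U (a (j + 1), b j)).1)
    (hB : ∀ j < T, ∀ i < j, (U (a (j + 1), b i)).2 ≤ (U (a (j + 1), b (j + 1))).2)
    (hN : ∀ t ≤ 2 * T, ¬ IsPNE U (brd U (a 0, b 0) t)) :
    ∀ j ≤ T, (brd U (a 0, b 0) (2 * j) = (a j, b j) ∧
        (0 < j → ∀ z, z ≠ b j → (U (a j, z)).2 < (U (a j, b j)).2)) ∧
      (j < T → (U (a j, b j)).1 < (U (a (j + 1), b j)).1 ∧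
        (U (a (j + 1), b j)).2 < (U (a (j + 1), b (j + 1))).2) := by
  have hneA : ∀ j < T, ∀ i ≤ j, a i ≠ a (j + 1) := fun j hj i hi he => by
    have := h.injA (by simp; omega) (by simp; omega) he
    omega
  have hneB : ∀ j < T, ∀ i ≤ j, b i ≠ b (j + 1) := fun j hj i hi he => by
    have := h.injB (by simp; omega) (by simp; omega) he
    omega
  have hltA : ∀ j < T, (U (a j, b j)).1 ≤ (U (a (j + 1), b j)).1 →
      ∀ z, z ≠ a (j + 1) → (U (z, b j)).1 < (U (a (j + 1), b j)).1 := by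
    intro j hj hle z hz
    by_cases hz' : ∃ i ≤ j, z = a i
    · obtain ⟨i, hi, rfl⟩ := hz'
      refine lt_of_le_of_ne ?_ (fun he => hz (hU.1 _ he))
      rcases hi.lt_or_eq with hi | rfl
      · exact hA j hj i (Or.inl hi)
      · exact hle
    · push Not at hz'
      exact h.col j hj z hz' hz
  have hltB : ∀ j < T, (U (a (j + 1), b j)).2 ≤ (U (a (j + 1), b (j + 1))).2 →
      ∀ z, z ≠ b (j + 1) → (U (a (j + 1), z)).2 < (U (a (j + 1), b (j + 1))).2 := by
    intro j hj hle z hz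
    by_cases hz' : ∃ i ≤ j, z = b i
    · obtain ⟨i, hi, rfl⟩ := hz'
      refine lt_of_le_of_ne ?_ (fun he => hz (hU.2 _ he))
      rcases hi.lt_or_eq with hi | rfl
      · exact hB j hj i hi
      · exact hle
    · push Not at hz'
      exact h.row j hj z hz' hz
  have step : ∀ j < T, brd U (a 0, b 0) (2 * j) = (a j, b j) →
      (0 < j → ∀ z, z ≠ b j → (U (a j, z)).2 < (U (a j, b j)).2) →
      ((U (a j, b j)).1 < (U (a (j + 1), b j)).1 ∧
        (U (a (j + 1), b j)).2 < (U (a (j + 1), b (j + 1))).2) ∧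
      brd U (a 0, b 0) (2 * (j + 1)) = (a (j + 1), b (j + 1)) := by
    intro j hj hbrd hopt
    have h1 : (U (a j, b j)).1 < (U (a (j + 1), b j)).1 := by
      -- At `j = 0` player B has not moved yet, so A's failure to improve would not produce an
      -- equilibrium. The clause `i = 0` of `hA` supplies the improvement instead.
      rcases Nat.eq_zero_or_pos j with rfl | hj0
      · exact hltA 0 hj (hA 0 hj 0 (Or.inr rfl)) _ (hneA 0 hj 0 le_rfl)
      · by_contra hcon
        rw [not_lt] at hcon
        -- If A cannot improve on `(a j, b j)`, this profile is an equilibrium, because `b j` was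
        -- B's global best reply to `a j`.
        refine hN (2 * j) (by omega) ?_
        rw [hbrd]
        refine ⟨fun x => ?_, fun y => ?_⟩
        · by_cases hx' : ∃ i ≤ j, x = a i
          · obtain ⟨i, hi, rfl⟩ := hx'
            rcases hi.lt_or_eq with hi | rfl
            · exact (hA j hj i (Or.inl hi)).trans hcon
            · exact le_rfl
          · push Not at hx'
            by_cases hx : x = a (j + 1)
            · rw [hx]; exact hcon
            · exact (h.col j hj x hx' hx).le.trans hcon
        · by_cases hy : y = b j
          · rw [hy]
          · exact (hopt hj0 y hy).le
    have hmaxA := hltA j hj h1.le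
    have hbrd1 : brd U (a 0, b 0) (2 * j + 1) = (a (j + 1), b j) := by
      rw [brd_even_succ, hbrd]
      simp only
      rw [respond_eq (argmaxA_eq hmaxA) (hneA j hj j le_rfl)]
    have h2 : (U (a (j + 1), b j)).2 < (U (a (j + 1), b (j + 1))).2 := by
      by_contra hcon
      rw [not_lt] at hcon
      refine hN (2 * j + 1) (by omega) ?_
      rw [hbrd1]
      refine ⟨fun x => ?_, fun y => ?_⟩
      · by_cases hx : x = a (j + 1)
        · rw [hx]
        · exact (hmaxA x hx).le
      · by_cases hy' : ∃ i ≤ j, y = b i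
        · obtain ⟨i, hi, rfl⟩ := hy'
          rcases hi.lt_or_eq with hi | rfl
          · exact (hB j hj i hi).trans hcon
          · exact le_rfl
        · push Not at hy'
          by_cases hy : y = b (j + 1)
          · rw [hy]; exact hcon
          · exact (h.row j hj y hy' hy).le.trans hcon
    refine ⟨⟨h1, h2⟩, ?_⟩
    rw [show 2 * (j + 1) = 2 * j + 2 by ring, brd_odd_succ, hbrd1]
    simp only
    rw [respond_eq (argmaxB_eq (hltB j hj h2.le)) (hneB j hj j le_rfl)]
  have main : ∀ j ≤ T, brd U (a 0, b 0) (2 * j) = (a j, b j) ∧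
      (0 < j → ∀ z, z ≠ b j → (U (a j, z)).2 < (U (a j, b j)).2) := by
    intro j
    induction j with
    | zero => intro _; exact ⟨rfl, fun h => absurd h (lt_irrefl 0)⟩
    | succ j ih =>
      intro hj
      obtain ⟨h1, h2⟩ := ih (by omega)
      obtain ⟨⟨h3, h4⟩, h5⟩ := step j (by omega) h1 h2
      exact ⟨h5, fun _ => hltB j (by omega) h4.le⟩
  intro j hj
  exact ⟨main j hj, fun hj' => (step j hj' (main j hj).1 (main j hj).2).1⟩

lemma ae_noTies {m k : ℕ} {p : ℝ} (hp0 : 0 < p) (hp1 : p ≤ 1) :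
    ∀ᵐ U ∂(gameLaw m k p), NoTies U := by
  have h : ∀ (e : Bool) (c c' : Profile m k), c ≠ c' →
      ∀ᵐ U ∂(gameLaw m k p), payoff e (U c) ≠ payoff e (U c') := by
    intro e c c' hc
    rw [ae_iff]
    simp only [ne_eq, not_not]
    exact pi_payoff_eq_null hp0 hp1 e hc
  have h' : ∀ᵐ U ∂(gameLaw m k p), ∀ (e : Bool) (c c' : Profile m k), c ≠ c' →
      payoff e (U c) ≠ payoff e (U c') := by
    simp only [ae_all_iff]
    exact h
  filter_upwards [h'] with U hU
  refine ⟨fun b x y hxy => ?_, fun a x y hxy => ?_⟩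
  · by_contra hne
    exact hU true (x, b) (y, b) (by simpa using hne) (by simpa [payoff] using hxy)
  · by_contra hne
    exact hU false (a, x) (a, y) (by simpa using hne) (by simpa [payoff] using hxy)

end Dynamics

/-! ### Probability bounds along prescribed paths and union over paths -/

section Paths

variable {m k T : ℕ}

/-- The fresh cells of column `b j` (`inl j`) and of row `a (j + 1)` (`inr j`). -/
def freshCells (a : Fin (T + 1) → Fin m) (b : Fin (T + 1) → Fin k) :
    Fin T ⊕ Fin T → Finset (Profile m k)
  | .inl j => (Finset.univ \ (Finset.Iic j.castSucc).image a) ×ˢ {b j.castSucc}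
  | .inr j => {a j.succ} ×ˢ (Finset.univ \ (Finset.Iic j.castSucc).image b)

/-- The exploration along a path without repeated actions. -/
def pathExploration (a : Fin (T + 1) → Fin m) (b : Fin (T + 1) → Fin k)
    (ha : Function.Injective a) (hb : Function.Injective b) :
    Exploration (Profile m k) (Fin T ⊕ Fin T) where
  C := freshCells a b
  x := Sum.elim (fun j => (a j.succ, b j.castSucc)) (fun j => (a j.succ, b j.succ))
  e := Sum.elim (fun _ => true) (fun _ => false)
  mem := by
    rintro (j | j)
    · simp only [freshCells, Sum.elim_inl, Finset.mem_product, Finset.mem_sdiff, Finset.mem_univ,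
        true_and, Finset.mem_image, Finset.mem_Iic, not_exists, not_and, Finset.mem_singleton,
        and_true]
      intro i hi h
      exact absurd (ha h ▸ hi) (not_le.2 j.castSucc_lt_succ)
    · simp only [freshCells, Sum.elim_inr, Finset.mem_product, Finset.mem_sdiff, Finset.mem_univ,
        true_and, Finset.mem_image, Finset.mem_Iic, not_exists, not_and, Finset.mem_singleton]
      intro i hi h
      exact absurd (hb h ▸ hi) (not_le.2 j.castSucc_lt_succ)
  disj := by
    have key : ∀ j j' : Fin T,
        Disjoint (freshCells a b (.inl j)) (freshCells a b (.inr j')) := by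
      intro j j'
      rw [Finset.disjoint_left]
      rintro ⟨x, y⟩ h1 h2
      simp only [freshCells, Finset.mem_product, Finset.mem_sdiff, Finset.mem_univ,
        true_and, Finset.mem_image, Finset.mem_Iic, not_exists, not_and,
        Finset.mem_singleton] at h1 h2
      obtain ⟨h1, rfl⟩ := h1
      obtain ⟨rfl, h2⟩ := h2
      have h3 : ¬ j'.succ ≤ j.castSucc := fun h => h1 _ h rfl
      have h4 : ¬ j.castSucc ≤ j'.castSucc := fun h => h2 _ h rfl
      simp only [Fin.le_def, Fin.val_succ, Fin.val_castSucc] at h3 h4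
      omega
    rintro (j | j) (j' | j') hne
    · rw [Finset.disjoint_left]
      rintro ⟨x, y⟩ h1 h2
      simp only [freshCells, Finset.mem_product, Finset.mem_singleton] at h1 h2
      exact hne (congrArg _ (Fin.castSucc_injective _ (hb (h1.2.symm.trans h2.2))))
    · exact key j j'
    · exact (key j' j).symm
    · rw [Finset.disjoint_left]
      rintro ⟨x, y⟩ h1 h2
      simp only [freshCells, Finset.mem_product, Finset.mem_singleton] at h1 h2
      exact hne (congrArg _ (Fin.succ_injective _ (ha (h1.1.symm.trans h2.1))))

lemma card_freshCells_inl {a : Fin (T + 1) → Fin m} (b : Fin (T + 1) → Fin k)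
    (ha : Function.Injective a) (j : Fin T) :
    (freshCells a b (.inl j)).card = m - 1 - j := by
  simp only [freshCells, Finset.card_product, Finset.card_singleton, mul_one]
  rw [Finset.card_sdiff_of_subset (Finset.subset_univ _), Finset.card_image_of_injective _ ha]
  simp
  omega

lemma card_freshCells_inr (a : Fin (T + 1) → Fin m) {b : Fin (T + 1) → Fin k}
    (hb : Function.Injective b) (j : Fin T) :
    (freshCells a b (.inr j)).card = k - 1 - j := by
  simp only [freshCells, Finset.card_product, Finset.card_singleton, one_mul]
  rw [Finset.card_sdiff_of_subset (Finset.subset_univ _), Finset.card_image_of_injective _ hb]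
  simp
  omega

/-- The value does not depend on the path, and it is the inverse of the bound on the number of pairs
of paths from `card_actionPath_le`. -/
lemma prod_card_freshCells {a : Fin (T + 1) → Fin m} {b : Fin (T + 1) → Fin k}
    (ha : Function.Injective a) (hb : Function.Injective b) :
    ∏ s, (1 / ((freshCells a b s).card : ℝ)) =
      1 / (((m - 1).descFactorial T : ℝ) * ((k - 1).descFactorial T : ℝ)) := by
  rw [Fintype.prod_sum_type]
  simp only [card_freshCells_inl b ha, card_freshCells_inr a hb, one_div,
    Finset.prod_inv_distrib, Nat.descFactorial_eq_prod_range, mul_inv]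
  rw [Fin.prod_univ_eq_prod_range (fun i => ((m - 1 - i : ℕ) : ℝ)),
    Fin.prod_univ_eq_prod_range (fun i => ((k - 1 - i : ℕ) : ℝ))]
  push_cast
  rfl

/-- Sequences of `T + 1` distinct actions with prescribed first action. -/
abbrev ActionPath (n T : ℕ) (x : Fin n) : Type :=
  {f : Fin (T + 1) → Fin n // Function.Injective f ∧ f 0 = x}

noncomputable instance (n T : ℕ) (x : Fin n) : Fintype (ActionPath n T x) :=
  Fintype.ofFinite _

lemma card_actionPath_le (n T : ℕ) (x : Fin n) :
    Fintype.card (ActionPath n T x) ≤ (n - 1).descFactorial T := by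
  classical
  let φ : ActionPath n T x → (Fin T ↪ {y : Fin n // y ≠ x}) := fun f =>
    ⟨fun j => ⟨f.1 j.succ, fun h => Fin.succ_ne_zero j (f.2.1 (h.trans f.2.2.symm))⟩,
      fun i j hij => Fin.succ_injective _ (f.2.1 (congrArg Subtype.val hij))⟩
  have hφ : Function.Injective φ := by
    intro f g hfg
    refine Subtype.ext (funext fun i => ?_)
    refine Fin.cases ?_ (fun j => ?_) i
    · rw [f.2.2, g.2.2]
    · exact congrArg Subtype.val (DFunLike.congr_fun hfg j)
  have := Fintype.card_le_of_injective φ hφ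
  rw [Fintype.card_embedding_eq, Fintype.card_fin] at this
  simpa [Fintype.card_subtype_compl] using this

/-- All pivots along the path are rejected. -/
def allRejected (a : Fin (T + 1) → Fin m) (b : Fin (T + 1) → Fin k) : Set (Game m k) :=
  {U | (∀ j : Fin T, (U (a j.succ, b j.castSucc)).2 < (U (a j.succ, b j.succ)).2) ∧
    ∀ j : Fin T, (U (a j.castSucc, b j.castSucc)).1 < (U (a j.succ, b j.castSucc)).1}

/-- Blocks must go from a larger set to one no larger, so the pairing depends on which player has
more actions: column `j` with row `j` if `k ≤ m`, and row `j` with column `j + 1` if `m ≤ k`. The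
second pairing has only `n` blocks. -/
lemma real_event_inter_allRejected_le {p : ℝ} (hp0 : 0 < p) (hp1 : p ≤ 1) {n : ℕ}
    {a : Fin (n + 1 + 1) → Fin m} {b : Fin (n + 1 + 1) → Fin k} (ha : Function.Injective a)
    (hb : Function.Injective b) :
    (gameLaw m k p).real ((pathExploration a b ha hb).event Finset.univ ∩ allRejected a b) ≤
      (1 - p / 2) ^ n * ∏ s, (1 / ((freshCells a b s).card : ℝ)) := by
  have := isProbabilityMeasure_payoffLaw hp0 hp1
  have hg : IsProbabilityMeasure (gameLaw m k p) := by unfold gameLaw; infer_instance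
  set X := pathExploration a b ha hb with hX
  have hpr : 0 ≤ ∏ s, (1 / ((freshCells a b s).card : ℝ)) :=
    Finset.prod_nonneg fun _ _ => by positivity
  rcases le_total k m with hkm | hkm
  · have h := X.real_event_inter_rejects_le hp0 hp1 (Sum.elim Sum.inr Sum.inr) Finset.univ
      (Finset.univ.map ⟨Sum.inl, Sum.inl_injective⟩) (by simp)
      (by
        intro r hr s hs hrs
        simp only [Finset.coe_map, Function.Embedding.coeFn_mk, Finset.coe_univ, Set.image_univ,
          Set.mem_range] at hr hs
        obtain ⟨i, rfl⟩ := hr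
        obtain ⟨j, rfl⟩ := hs
        simpa using hrs)
      (by simp) (by simp [hX, pathExploration])
      (by
        intro r hr
        simp only [Finset.mem_map, Finset.mem_univ, true_and, Function.Embedding.coeFn_mk] at hr
        obtain ⟨i, rfl⟩ := hr
        simp only [hX, pathExploration, Sum.elim_inl, card_freshCells_inl b ha,
          card_freshCells_inr a hb]
        omega)
    rw [Finset.card_map, Finset.card_univ, Fintype.card_fin] at h
    refine (measureReal_mono ?_).trans (h.trans ?_)
    · rintro U ⟨h1, h2⟩
      refine ⟨h1, fun q hq => ?_⟩
      simp only [Finset.mem_map, Finset.mem_univ, true_and, Function.Embedding.coeFn_mk] at hq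
      obtain ⟨j, rfl⟩ := hq
      simpa [hX, pathExploration, payoff] using h2.1 j
    · refine mul_le_mul_of_nonneg_right ?_ hpr
      exact pow_le_pow_of_le_one (by linarith) (by linarith) (Nat.le_succ n)
  · let φ : Fin n → Fin (n + 1) ⊕ Fin (n + 1) := fun j => Sum.inr j.castSucc
    -- The cyclic wrap of `j + 1` at the last index is harmless: `nxt` matters only on the range of
    -- `φ`, which omits that index.
    let nxt : Fin (n + 1) ⊕ Fin (n + 1) → Fin (n + 1) ⊕ Fin (n + 1) :=
      Sum.elim Sum.inl (fun j => Sum.inl (j + 1))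
    have hφ : Function.Injective φ := fun i j hij =>
      Fin.castSucc_injective _ (Sum.inr_injective hij)
    have hnxt : ∀ j, nxt (φ j) = Sum.inl j.succ := fun j => by
      simp [nxt, φ, Fin.coeSucc_eq_succ]
    have h := X.real_event_inter_rejects_le hp0 hp1 nxt Finset.univ
      (Finset.univ.image φ) (by simp)
      (by
        intro r hr s hs hrs
        simp only [Finset.coe_image, Finset.coe_univ, Set.image_univ, Set.mem_range] at hr hs
        obtain ⟨i, rfl⟩ := hr
        obtain ⟨j, rfl⟩ := hs
        rw [hnxt, hnxt] at hrs
        rw [Fin.succ_injective _ (Sum.inl_injective hrs)])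
      (by simp [hnxt, φ])
      (by
        intro r hr
        obtain ⟨i, -, rfl⟩ := Finset.mem_image.1 hr
        rw [hnxt]
        simp [hX, pathExploration, φ])
      (by
        intro r hr
        obtain ⟨i, -, rfl⟩ := Finset.mem_image.1 hr
        rw [hnxt]
        simp only [hX, pathExploration, φ, card_freshCells_inl b ha, card_freshCells_inr a hb,
          Fin.val_succ, Fin.val_castSucc]
        omega)
    rw [Finset.card_image_of_injective _ hφ, Finset.card_univ, Fintype.card_fin] at h
    refine (measureReal_mono ?_).trans h
    rintro U ⟨h1, h2⟩
    refine ⟨h1, fun q hq => ?_⟩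
    obtain ⟨j, -, rfl⟩ := Finset.mem_image.1 hq
    rw [hnxt]
    exact h2.2 j.succ

/-- The used row `a i` beats the fresh maximum of column `b j`. -/
def usedRowWins (a : Fin (T + 1) → Fin m) (b : Fin (T + 1) → Fin k)
    (q : Fin (T + 1) × Fin T) : Set (Game m k) :=
  {U | (q.1 < q.2.castSucc ∨ q.1 = 0) ∧
    (U (a q.2.succ, b q.2.castSucc)).1 < (U (a q.1, b q.2.castSucc)).1}

/-- The used column `b i` beats the fresh maximum of row `a (j + 1)`. -/
def usedColWins (a : Fin (T + 1) → Fin m) (b : Fin (T + 1) → Fin k)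
    (q : Fin (T + 1) × Fin T) : Set (Game m k) :=
  {U | q.1 < q.2.castSucc ∧
    (U (a q.2.succ, b q.2.succ)).2 < (U (a q.2.succ, b q.1)).2}

lemma two_div_card_le {N : ℕ} {K : ℕ} (hK : T + 2 ≤ K) (hN : K ≤ N) (j : Fin T) :
    2 / (((N - 1 - j : ℕ) : ℝ) + 1) ≤ 2 / ((K : ℝ) - T) := by
  have h2 : ((T : ℝ) + 2) ≤ K := by exact_mod_cast hK
  refine div_le_div_of_nonneg_left (by norm_num) (by linarith) ?_
  have : K ≤ N - 1 - j + 1 + T := by omega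
  have : (K : ℝ) ≤ ((N - 1 - j : ℕ) : ℝ) + 1 + T := by exact_mod_cast this
  linarith

lemma two_le_card_freshCells {K : ℕ} (hK : T + 2 ≤ K) (hm : K ≤ m) (hk : K ≤ k)
    {a : Fin (T + 1) → Fin m} {b : Fin (T + 1) → Fin k} (ha : Function.Injective a)
    (hb : Function.Injective b) (s : Fin T ⊕ Fin T) : 2 ≤ (freshCells a b s).card := by
  rcases s with j | j
  · rw [card_freshCells_inl b ha]; omega
  · rw [card_freshCells_inr a hb]; omega

lemma real_usedRowWins_le {p : ℝ} (hp0 : 0 < p) (hp1 : p ≤ 1) {K : ℕ} (hK : T + 2 ≤ K)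
    (hm : K ≤ m) (hk : K ≤ k) {a : Fin (T + 1) → Fin m} {b : Fin (T + 1) → Fin k}
    (ha : Function.Injective a) (hb : Function.Injective b) (q : Fin (T + 1) × Fin T) :
    (gameLaw m k p).real ((pathExploration a b ha hb).event Finset.univ ∩ usedRowWins a b q) ≤
      2 / ((K : ℝ) - T) * ∏ s, (1 / ((freshCells a b s).card : ℝ)) := by
  have := isProbabilityMeasure_payoffLaw hp0 hp1
  have hg : IsProbabilityMeasure (gameLaw m k p) := by unfold gameLaw; infer_instance
  obtain ⟨i, j⟩ := q
  have hpr : 0 ≤ ∏ s, (1 / ((freshCells a b s).card : ℝ)) :=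
    Finset.prod_nonneg fun _ _ => by positivity
  have hKT : 0 ≤ 2 / ((K : ℝ) - T) := by
    have h2 : ((T : ℝ) + 2) ≤ K := by exact_mod_cast hK
    exact div_nonneg (by norm_num) (by linarith)
  by_cases hij : i < j.castSucc ∨ i = 0
  swap
  · have : usedRowWins a b (i, j) = ∅ := by
      ext U; simp only [usedRowWins, Set.mem_ofPred_eq, hij, false_and, Set.mem_empty_iff_false]
    rw [this]
    simpa using mul_nonneg hKT hpr
  have hle : i ≤ j.castSucc := by
    rcases hij with h | rfl
    · exact h.le
    · exact Fin.zero_le _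
  -- The competitor `d` must never be a selected cell. The only danger is `i = j > 0`, the pivot `(a
  -- j, b j)`, which the condition `hij` rules out; the starting cell is never selected.
  have h := (pathExploration a b ha hb).real_event_inter_lt_le hp0 hp1 Finset.univ
    (Finset.mem_univ (Sum.inl j)) (d := (a i, b j.castSucc))
    (by
      simp only [pathExploration, freshCells, Finset.mem_product, Finset.mem_sdiff,
        Finset.mem_univ, true_and, Finset.mem_image, Finset.mem_Iic]
      exact fun h => h.1 ⟨i, hle, rfl⟩)
    (by
      rintro (l | l) h
      · simp only [pathExploration, Sum.elim_inl, Prod.mk.injEq] at h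
        have h1 := ha h.1
        have h2 := Fin.castSucc_injective _ (hb h.2)
        subst h2
        rw [h1] at hle
        exact absurd hle (not_le.2 j.castSucc_lt_succ)
      · simp only [pathExploration, Sum.elim_inr, Prod.mk.injEq] at h
        have h1 := ha h.1
        have h2 := hb h.2
        rw [h1, h2] at hij
        rcases hij with h | h
        · exact lt_irrefl _ h
        · exact Fin.succ_ne_zero _ h)
    (fun s _ => two_le_card_freshCells hK hm hk ha hb s)
  refine (measureReal_mono ?_).trans (h.trans (mul_le_mul_of_nonneg_right ?_ hpr))
  · rintro U ⟨h1, -, h2⟩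
    exact ⟨h1, h2⟩
  · simp only [pathExploration, card_freshCells_inl b ha]
    exact two_div_card_le hK hm j

lemma real_usedColWins_le {p : ℝ} (hp0 : 0 < p) (hp1 : p ≤ 1) {K : ℕ} (hK : T + 2 ≤ K)
    (hm : K ≤ m) (hk : K ≤ k) {a : Fin (T + 1) → Fin m} {b : Fin (T + 1) → Fin k}
    (ha : Function.Injective a) (hb : Function.Injective b) (q : Fin (T + 1) × Fin T) :
    (gameLaw m k p).real ((pathExploration a b ha hb).event Finset.univ ∩ usedColWins a b q) ≤
      2 / ((K : ℝ) - T) * ∏ s, (1 / ((freshCells a b s).card : ℝ)) := by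
  have := isProbabilityMeasure_payoffLaw hp0 hp1
  have hg : IsProbabilityMeasure (gameLaw m k p) := by unfold gameLaw; infer_instance
  obtain ⟨i, j⟩ := q
  have hpr : 0 ≤ ∏ s, (1 / ((freshCells a b s).card : ℝ)) :=
    Finset.prod_nonneg fun _ _ => by positivity
  have hKT : 0 ≤ 2 / ((K : ℝ) - T) := by
    have h2 : ((T : ℝ) + 2) ≤ K := by exact_mod_cast hK
    exact div_nonneg (by norm_num) (by linarith)
  by_cases hij : i < j.castSucc
  swap
  · have : usedColWins a b (i, j) = ∅ := by
      ext U; simp only [usedColWins, Set.mem_ofPred_eq, hij, false_and, Set.mem_empty_iff_false]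
    rw [this]
    simpa using mul_nonneg hKT hpr
  have h := (pathExploration a b ha hb).real_event_inter_lt_le hp0 hp1 Finset.univ
    (Finset.mem_univ (Sum.inr j)) (d := (a j.succ, b i))
    (by
      simp only [pathExploration, freshCells, Finset.mem_product, Finset.mem_sdiff,
        Finset.mem_univ, true_and, Finset.mem_image, Finset.mem_Iic]
      exact fun h => h.2 ⟨i, hij.le, rfl⟩)
    (by
      rintro (l | l) h
      · simp only [pathExploration, Sum.elim_inl, Prod.mk.injEq] at h
        have h1 := Fin.succ_injective _ (ha h.1)
        have h2 := hb h.2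
        subst h1
        rw [h2] at hij
        exact lt_irrefl _ hij
      · simp only [pathExploration, Sum.elim_inr, Prod.mk.injEq] at h
        have h1 := Fin.succ_injective _ (ha h.1)
        have h2 := hb h.2
        subst h1
        rw [h2] at hij
        exact lt_asymm hij j.castSucc_lt_succ)
    (fun s _ => two_le_card_freshCells hK hm hk ha hb s)
  refine (measureReal_mono ?_).trans (h.trans (mul_le_mul_of_nonneg_right ?_ hpr))
  · rintro U ⟨h1, -, h2⟩
    exact ⟨h1, h2⟩
  · simp only [pathExploration, card_freshCells_inr a hb]
    exact two_div_card_le hK hk j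

/-- The path is the fresh path, and it reaches no equilibrium or leaves the dynamics. -/
def badPath (a : Fin (T + 1) → Fin m) (b : Fin (T + 1) → Fin k) (ha : Function.Injective a)
    (hb : Function.Injective b) : Set (Game m k) :=
  (pathExploration a b ha hb).event Finset.univ ∩ allRejected a b ∪
    ((⋃ q ∈ Finset.univ, (pathExploration a b ha hb).event Finset.univ ∩ usedRowWins a b q) ∪
      ⋃ q ∈ Finset.univ, (pathExploration a b ha hb).event Finset.univ ∩ usedColWins a b q)

/-- Bound on the probability that no equilibrium is visited up to time `2 * (n + 1)`. -/
noncomputable def failureBound (p : ℝ) (K n : ℕ) : ℝ :=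
  (1 - p / 2) ^ n + 4 * ((n + 2) * (n + 1)) / ((K : ℝ) - (n + 1))

lemma real_badPath_le {p : ℝ} (hp0 : 0 < p) (hp1 : p ≤ 1) {K n : ℕ} (hK : n + 1 + 2 ≤ K)
    (hm : K ≤ m) (hk : K ≤ k) {a : Fin (n + 1 + 1) → Fin m} {b : Fin (n + 1 + 1) → Fin k}
    (ha : Function.Injective a) (hb : Function.Injective b) :
    (gameLaw m k p).real (badPath a b ha hb) ≤
      failureBound p K n *
        (1 / (((m - 1).descFactorial (n + 1) : ℝ) * ((k - 1).descFactorial (n + 1) : ℝ))) := by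
  have := isProbabilityMeasure_payoffLaw hp0 hp1
  have hg : IsProbabilityMeasure (gameLaw m k p) := by unfold gameLaw; infer_instance
  rw [← prod_card_freshCells ha hb]
  set P := ∏ s, (1 / ((freshCells a b s).card : ℝ))
  have h1 := real_event_inter_allRejected_le hp0 hp1 ha hb
  have h2 := (measureReal_biUnion_finset_le (μ := gameLaw m k p) Finset.univ
    (fun q => (pathExploration a b ha hb).event Finset.univ ∩ usedRowWins a b q)).trans
      (Finset.sum_le_sum fun q _ => real_usedRowWins_le hp0 hp1 hK hm hk ha hb q)
  have h3 := (measureReal_biUnion_finset_le (μ := gameLaw m k p) Finset.univ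
    (fun q => (pathExploration a b ha hb).event Finset.univ ∩ usedColWins a b q)).trans
      (Finset.sum_le_sum fun q _ => real_usedColWins_le hp0 hp1 hK hm hk ha hb q)
  simp only [Finset.sum_const, Finset.card_univ, Fintype.card_prod, Fintype.card_fin,
    nsmul_eq_mul] at h2 h3
  push_cast at h2 h3
  calc _ ≤ _ := measureReal_union_le _ _
    _ ≤ _ := add_le_add h1 ((measureReal_union_le _ _).trans (add_le_add h2 h3))
    _ = _ := by
      unfold failureBound
      ring

/-- The witness is the game's own fresh path: either some used action wins on it, or
`IsFreshPath.follow` shows that every pivot is rejected. -/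
lemma noTies_subset_badPath {n : ℕ} (hm : n + 1 < m) (hk : n + 1 < k) (s : Profile m k)
    {U : Game m k} (hU : NoTies U) (hN : ∀ t ≤ 2 * (n + 1), ¬ IsPNE U (brd U s t)) :
    ∃ (f : ActionPath m (n + 1) s.1) (g : ActionPath k (n + 1) s.2),
      U ∈ badPath f.1 g.1 f.2.1 g.2.1 := by
  obtain ⟨a, b, ha0, hb0, h⟩ := exists_isFreshPath hU s (n + 1) hm hk
  have hle : ∀ i : Fin (n + 1 + 1), (i : ℕ) ∈ Set.Iic (n + 1) := fun i => by
    have := i.2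
    simp only [Set.mem_Iic]; omega
  let f : ActionPath m (n + 1) s.1 := ⟨fun i => a i,
    fun i j hij => Fin.ext (h.injA (hle i) (hle j) hij), ha0⟩
  let g : ActionPath k (n + 1) s.2 := ⟨fun i => b i,
    fun i j hij => Fin.ext (h.injB (hle i) (hle j) hij), hb0⟩
  refine ⟨f, g, ?_⟩
  have hev : U ∈ (pathExploration f.1 g.1 f.2.1 g.2.1).event Finset.univ := by
    rintro (j | j) - ⟨x, y⟩ hc hne
    · simp only [pathExploration, freshCells, Finset.mem_product, Finset.mem_sdiff,
        Finset.mem_univ, true_and, Finset.mem_image, Finset.mem_Iic, not_exists, not_and,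
        Finset.mem_singleton, Sum.elim_inl] at hc hne ⊢
      obtain ⟨hx, rfl⟩ := hc
      refine h.col j j.2 x (fun i hi he => ?_) (fun he => hne (by rw [he]; rfl))
      exact hx ⟨i, by omega⟩ (by simpa [Fin.le_def] using hi) he.symm
    · simp only [pathExploration, freshCells, Finset.mem_product, Finset.mem_sdiff,
        Finset.mem_univ, true_and, Finset.mem_image, Finset.mem_Iic, not_exists, not_and,
        Finset.mem_singleton, Sum.elim_inr] at hc hne ⊢
      obtain ⟨rfl, hy⟩ := hc
      refine h.row j j.2 y (fun i hi he => ?_) (fun he => hne (by rw [he]; rfl))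
      exact hy ⟨i, by omega⟩ (by simpa [Fin.le_def] using hi) he.symm
  by_cases hA : ∃ q, U ∈ usedRowWins f.1 g.1 q
  · obtain ⟨q, hq⟩ := hA
    exact Or.inr (Or.inl (Set.mem_biUnion (Finset.mem_univ q) ⟨hev, hq⟩))
  by_cases hB : ∃ q, U ∈ usedColWins f.1 g.1 q
  · obtain ⟨q, hq⟩ := hB
    exact Or.inr (Or.inr (Set.mem_biUnion (Finset.mem_univ q) ⟨hev, hq⟩))
  push Not at hA hB
  have hfol := h.follow hU
    (fun j hj i hi => by
      by_contra hcon
      rw [not_le] at hcon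
      refine hA (⟨i, by omega⟩, ⟨j, hj⟩) ⟨?_, hcon⟩
      rcases hi with hi | hi
      · exact Or.inl (by simpa [Fin.lt_def] using hi)
      · exact Or.inr (Fin.ext hi))
    (fun j hj i hi => by
      by_contra hcon
      rw [not_le] at hcon
      exact hB (⟨i, by omega⟩, ⟨j, hj⟩) ⟨by simpa [Fin.lt_def] using hi, hcon⟩)
    (by rw [ha0, hb0]; exact hN)
  refine Or.inl ⟨hev, fun j => ?_, fun j => ?_⟩
  · exact ((hfol j j.2.le).2 j.2).2
  · exact ((hfol j j.2.le).2 j.2).1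

/-- Nonasymptotic bound on the time needed to reach an equilibrium. -/
lemma real_no_equilibrium_le {p : ℝ} (hp0 : 0 < p) (hp1 : p ≤ 1) {K n : ℕ} (hK : n + 1 + 2 ≤ K)
    (hm : K ≤ m) (hk : K ≤ k) (s : Profile m k) :
    (gameLaw m k p).real {U | ∀ t ≤ 2 * (n + 1), ¬ IsPNE U (brd U s t)} ≤
      failureBound p K n := by
  have := isProbabilityMeasure_payoffLaw hp0 hp1
  have hg : IsProbabilityMeasure (gameLaw m k p) := by unfold gameLaw; infer_instance
  let Bad : ActionPath m (n + 1) s.1 × ActionPath k (n + 1) s.2 → Set (Game m k) :=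
    fun π => badPath π.1.1 π.2.1 π.1.2.1 π.2.2.1
  have hsub : (gameLaw m k p).real {U | ∀ t ≤ 2 * (n + 1), ¬ IsPNE U (brd U s t)} ≤
      (gameLaw m k p).real (⋃ π ∈ Finset.univ, Bad π) := by
    refine ENNReal.toReal_mono (measure_ne_top _ _) (measure_mono_ae ?_)
    filter_upwards [ae_noTies hp0 hp1] with U hU hN
    obtain ⟨f, g, hfg⟩ := noTies_subset_badPath (by omega) (by omega) s hU hN
    exact Set.mem_biUnion (Finset.mem_univ (f, g)) hfg
  have hK' : ((n : ℝ) + 1 + 2) ≤ K := by exact_mod_cast hK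
  have hR : 0 ≤ failureBound p K n := by
    have h1 : 0 ≤ (1 - p / 2) ^ n := pow_nonneg (by linarith) n
    have h2 : 0 ≤ 4 * (((n : ℝ) + 2) * (n + 1)) / ((K : ℝ) - (n + 1)) :=
      div_nonneg (by positivity) (by linarith)
    unfold failureBound; linarith
  refine hsub.trans ((measureReal_biUnion_finset_le _ _).trans ((Finset.sum_le_sum fun π _ =>
    real_badPath_le hp0 hp1 hK hm hk π.1.2.1 π.2.2.1).trans ?_))
  rw [Finset.sum_const, Finset.card_univ, Fintype.card_prod, nsmul_eq_mul]
  have hd1 : (0 : ℝ) < (m - 1).descFactorial (n + 1) := by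
    exact_mod_cast Nat.pos_of_ne_zero (by rw [Ne, Nat.descFactorial_eq_zero_iff_lt]; omega)
  have hd2 : (0 : ℝ) < (k - 1).descFactorial (n + 1) := by
    exact_mod_cast Nat.pos_of_ne_zero (by rw [Ne, Nat.descFactorial_eq_zero_iff_lt]; omega)
  have hc1 : (Fintype.card (ActionPath m (n + 1) s.1) : ℝ) ≤ (m - 1).descFactorial (n + 1) := by
    exact_mod_cast card_actionPath_le m (n + 1) s.1
  have hc2 : (Fintype.card (ActionPath k (n + 1) s.2) : ℝ) ≤ (k - 1).descFactorial (n + 1) := by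
    exact_mod_cast card_actionPath_le k (n + 1) s.2
  push_cast
  -- The number of paths cancels against the common bound on the probability of a path.
  rw [mul_one_div, ← mul_div_assoc, div_le_iff₀ (by positivity), mul_comm]
  exact mul_le_mul_of_nonneg_left (mul_le_mul hc1 hc2 (by positivity) hd1.le) hR

end Paths

/-! ### Choice of the time horizon and passage to the limit -/

section Asymptotics

/-- The hypothesis says `p = f ^ o(1)`, so `p * f = f ^ (1 + o(1))`. -/
lemma tendsto_mul_atTop_of_log_div {p f : ℕ → ℝ} (hp : ∀ n, 0 < p n)
    (hf : Tendsto f atTop atTop)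
    (h : Tendsto (fun n => Real.log (p n) / Real.log (f n)) atTop (𝓝 0)) :
    Tendsto (fun n => p n * f n) atTop atTop := by
  have hlog : Tendsto (fun n => Real.log (f n)) atTop atTop := Real.tendsto_log_atTop.comp hf
  have h1 : Tendsto (fun n => Real.log (f n) * (1 + Real.log (p n) / Real.log (f n)))
      atTop atTop :=
    hlog.atTop_mul_pos (C := 1) one_pos (by simpa using tendsto_const_nhds.add h)
  refine (Real.tendsto_exp_atTop.comp h1).congr' ?_
  filter_upwards [hf.eventually_gt_atTop 1] with n hn
  have hl : Real.log (f n) ≠ 0 := (Real.log_pos hn).ne'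
  have : Real.log (f n) * (1 + Real.log (p n) / Real.log (f n)) =
      Real.log (p n) + Real.log (f n) := by
    field_simp
    ring
  rw [Function.comp_apply, this, Real.exp_add, Real.exp_log (hp n), Real.exp_log (by linarith)]

lemma failureBound_le {p L x : ℝ} {K : ℕ} (hp0 : 0 < p) (hp1 : p ≤ 1) (hL : 4 ≤ L) (hx : L ≤ x)
    (hK : (K : ℝ) = x ^ 4) :
    failureBound p K ⌊L / 4⌋₊ ≤ Real.exp (-(p * L / 8 - 1 / 2)) + 8 / x := by
  set n := ⌊L / 4⌋₊
  have hn1 : (n : ℝ) ≤ L / 4 := Nat.floor_le (by linarith)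
  have hn2 : L / 4 < n + 1 := Nat.lt_floor_add_one _
  have hx4 : 4 ≤ x := hL.trans hx
  unfold failureBound
  refine add_le_add ?_ ?_
  · calc (1 - p / 2) ^ n ≤ (Real.exp (-(p / 2))) ^ n := by
          refine pow_le_pow_left₀ (by linarith) ?_ n
          have := Real.add_one_le_exp (-(p / 2))
          linarith
      _ = Real.exp (-(p * n / 2)) := by
          rw [← Real.exp_nat_mul]; congr 1; ring
      _ ≤ _ := by
          -- Rounding down loses at most one in `n > L/4 - 1`, which costs `p/2 ≤ 1/2` in the
          -- exponent.
          refine Real.exp_le_exp.2 ?_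
          nlinarith
  · have h3 : ((n : ℝ) + 2) * (n + 1) ≤ x * x := by
      refine mul_le_mul ?_ ?_ (by positivity) (by linarith) <;> linarith
    have h64 : 64 ≤ x ^ 3 := by
      calc (64 : ℝ) = 4 ^ 3 := by norm_num
        _ ≤ x ^ 3 := pow_le_pow_left₀ (by norm_num) hx4 3
    have h4 : x ^ 4 / 2 ≤ (K : ℝ) - (n + 1) := by
      rw [hK]
      nlinarith
    have hpos : 0 < x ^ 4 / 2 := by positivity
    calc 4 * (((n : ℝ) + 2) * (n + 1)) / ((K : ℝ) - (n + 1))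
        ≤ 4 * (x * x) / (x ^ 4 / 2) := by
          refine div_le_div₀ (by positivity) (by linarith) hpos h4
      _ = 8 / x ^ 2 := by field_simp; ring
      _ ≤ 8 / x := by
          refine div_le_div_of_nonneg_left (by norm_num) (by linarith) ?_
          nlinarith

lemma subset_no_equilibrium {m k : ℕ} (s : Profile m k) {ℓ : ℝ} {T : ℕ} (hT : (T : ℝ) ≤ ℓ) :
    {U : Game m k | (ℓ : EReal) < ((tauNE U s : ENNReal) : EReal)} ⊆
      {U | ∀ t ≤ T, ¬ IsPNE U (brd U s t)} := by
  intro U hU t ht hP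
  have h1 : tauNE U s ≤ (t : ℕ∞) := iInf₂_le t hP
  have h2 : ((tauNE U s : ENNReal) : EReal) ≤ ((((t : ℕ∞) : ENNReal)) : EReal) := by
    exact_mod_cast h1
  have h3 : ((((t : ℕ∞) : ENNReal)) : EReal) = ((t : ℝ) : EReal) := by
    rw [ENat.toENNReal_coe]; rfl
  have h4 : ((t : ℝ) : EReal) ≤ (ℓ : EReal) :=
    EReal.coe_le_coe_iff.2 ((Nat.cast_le.2 ht).trans hT)
  rw [h3] at h2
  exact absurd (h2.trans h4) (not_le.2 hU)

lemma tendsto_gameLaw_lt_tauNE (KA KB : ℕ → ℕ) (s : ∀ n, Profile (KA n) (KB n))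
    (hKA_top : Tendsto KA atTop atTop) (hKB_top : Tendsto KB atTop atTop)
    (p : ℕ → ℝ) (hp_pos : ∀ n, 0 < p n) (hp_le : ∀ n, p n ≤ 1)
    (hp : Tendsto (fun n => Real.log (p n) / Real.log ((min (KA n) (KB n) : ℕ) : ℝ))
      atTop (𝓝 0))
    (ℓ : ℕ → ℝ) (hℓ : Tendsto ℓ atTop atTop)
    (hpℓ : Tendsto (fun n => Real.log (p n) / Real.log (ℓ n)) atTop (𝓝 0)) :
    Tendsto (fun n => gameLaw (KA n) (KB n) (p n)
        {U | (ℓ n : EReal) < ((tauNE U (s n) : ENNReal) : EReal)}) atTop (𝓝 0) := by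
  set K : ℕ → ℕ := fun n => min (KA n) (KB n) with hKdef
  have hK : Tendsto (fun n => (K n : ℝ)) atTop atTop := by
    refine tendsto_natCast_atTop_atTop.comp (tendsto_atTop.2 fun N => ?_)
    filter_upwards [hKA_top.eventually_ge_atTop N, hKB_top.eventually_ge_atTop N] with n h1 h2
    exact le_min h1 h2
  set x : ℕ → ℝ := fun n => (K n : ℝ) ^ (1 / 4 : ℝ) with hxdef
  have hx : Tendsto x atTop atTop := (tendsto_rpow_atTop (by norm_num)).comp hK
  have hpx : Tendsto (fun n => Real.log (p n) / Real.log (x n)) atTop (𝓝 0) := by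
    have h4 := hp.const_mul 4
    rw [mul_zero] at h4
    refine h4.congr' ?_
    filter_upwards [hK.eventually_gt_atTop 0] with n hn
    simp only [hxdef]
    rw [Real.log_rpow hn, mul_comm (1 / 4 : ℝ), ← div_div]
    simp only [hKdef]
    -- The factor `4` undoes the exponent `1/4` inside the logarithm.
    ring
  set L : ℕ → ℝ := fun n => min (ℓ n) (x n) with hLdef
  have hL : Tendsto L atTop atTop := by
    refine tendsto_atTop.2 fun N => ?_
    filter_upwards [hℓ.eventually_ge_atTop N, hx.eventually_ge_atTop N] with n h1 h2
    exact le_min h1 h2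
  have hpL : Tendsto (fun n => p n * L n) atTop atTop := by
    refine tendsto_atTop.2 fun N => ?_
    filter_upwards [(tendsto_mul_atTop_of_log_div hp_pos hℓ hpℓ).eventually_ge_atTop N,
      (tendsto_mul_atTop_of_log_div hp_pos hx hpx).eventually_ge_atTop N] with n h1 h2
    rcases min_choice (ℓ n) (x n) with h | h <;> simp only [hLdef, h] <;> assumption
  have hbound : Tendsto (fun n => Real.exp (-(p n * L n / 8 - 1 / 2)) + 8 / x n)
      atTop (𝓝 0) := by
    have h1 : Tendsto (fun n => p n * L n / 8 - 1 / 2) atTop atTop :=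
      tendsto_atTop_add_const_right _ _ (hpL.atTop_div_const (by norm_num))
    have h2 := Real.tendsto_exp_neg_atTop_nhds_zero.comp h1
    have h3 : Tendsto (fun n => 8 / x n) atTop (𝓝 0) := hx.const_div_atTop 8
    simpa using h2.add h3
  have hofReal := ENNReal.tendsto_ofReal hbound
  rw [ENNReal.ofReal_zero] at hofReal
  refine tendsto_of_tendsto_of_tendsto_of_le_of_le' tendsto_const_nhds hofReal
    (Eventually.of_forall fun _ => zero_le) ?_
  filter_upwards [hL.eventually_ge_atTop 4] with n hLn
  have hLx : L n ≤ x n := min_le_right _ _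
  have hLℓ : L n ≤ ℓ n := min_le_left _ _
  have hKx : (K n : ℝ) = x n ^ 4 := by
    simp only [hxdef]
    rw [← Real.rpow_natCast, ← Real.rpow_mul (Nat.cast_nonneg _)]
    norm_num
  have hfl : (⌊L n / 4⌋₊ : ℝ) ≤ L n / 4 := Nat.floor_le (by linarith)
  -- The horizon is at most `L/2 + 2`, which is at most `L` once `L ≥ 4`.
  have hT : ((2 * (⌊L n / 4⌋₊ + 1) : ℕ) : ℝ) ≤ ℓ n := by
    push_cast
    linarith
  have hKn : ⌊L n / 4⌋₊ + 1 + 2 ≤ K n := by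
    have h64 : x n ≤ x n ^ 4 := le_self_pow₀ (by linarith) (by norm_num)
    have : ((⌊L n / 4⌋₊ : ℝ) + 1 + 2) ≤ K n := by
      rw [hKx]; linarith
    exact_mod_cast this
  have := isProbabilityMeasure_payoffLaw (hp_pos n) (hp_le n)
  have hg : IsProbabilityMeasure (gameLaw (KA n) (KB n) (p n)) := by
    unfold gameLaw; infer_instance
  refine (measure_mono (subset_no_equilibrium (s n) hT)).trans ?_
  refine (ENNReal.le_ofReal_iff_toReal_le (measure_ne_top _ _) ?_).2 ?_
  · have : 0 < x n := by linarith
    positivity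
  · exact (real_no_equilibrium_le (hp_pos n) (hp_le n) hKn (min_le_left _ _)
      (min_le_right _ _) (s n)).trans (failureBound_le (hp_pos n) (hp_le n) hLn hLx hKx)

end Asymptotics

end RandomGame

theorem mainTheorem2 (KA KB : ℕ → ℕ) (hKA : ∀ n, 0 < KA n) (hKB : ∀ n, 0 < KB n)
    (hKA_top : Tendsto KA atTop atTop) (hKB_top : Tendsto KB atTop atTop)
    (p : ℕ → ℝ) (hp_pos : ∀ n, 0 < p n) (hp_le : ∀ n, p n ≤ 1)
    (hp : Tendsto (fun n => Real.log (p n) / Real.log ((min (KA n) (KB n) : ℕ) : ℝ))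
      atTop (𝓝 0)) :
    (∀ ℓ : ℕ → ℝ, Tendsto ℓ atTop atTop →
      Tendsto (fun n => Real.log (p n) / Real.log (ℓ n)) atTop (𝓝 0) →
      Tendsto (fun n => RandomGame.gameLaw (KA n) (KB n) (p n)
        {U | (ℓ n : EReal) <
          ((RandomGame.tauNE U (⟨0, hKA n⟩, ⟨0, hKB n⟩) : ENNReal) : EReal)})
        atTop (𝓝 0)) ∧
    Tendsto (fun n => RandomGame.gameLaw (KA n) (KB n) (p n)
      {U | RandomGame.tauNE U (⟨0, hKA n⟩, ⟨0, hKB n⟩) = ⊤}) atTop (𝓝 0) := by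
  have key := RandomGame.tendsto_gameLaw_lt_tauNE KA KB (fun n => (⟨0, hKA n⟩, ⟨0, hKB n⟩))
    hKA_top hKB_top p hp_pos hp_le hp
  refine ⟨key, ?_⟩
  have hK : Tendsto (fun n => ((min (KA n) (KB n) : ℕ) : ℝ)) atTop atTop := by
    refine tendsto_natCast_atTop_atTop.comp (tendsto_atTop.2 fun N => ?_)
    filter_upwards [hKA_top.eventually_ge_atTop N, hKB_top.eventually_ge_atTop N] with n h1 h2
    exact le_min h1 h2
  -- The choice `ℓ = K` is admissible: its log condition is exactly `hp`.
  refine tendsto_of_tendsto_of_tendsto_of_le_of_le tendsto_const_nhds (key _ hK hp)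
    (fun _ => zero_le) (fun n => measure_mono fun U hU => ?_)
  have hU' : RandomGame.tauNE U (⟨0, hKA n⟩, ⟨0, hKB n⟩) = ⊤ := hU
  simp only [Set.mem_ofPred_eq, hU', ENat.toENNReal_top, EReal.coe_ennreal_top]
  exact EReal.coe_lt_top _
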